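/- **Definitions.** Let $B$ be a unital C*-algebra. For positive $a,b\in B$ write $a\precsim_B b$ ($a$ is Cuntz subequivalent to $b$) if there is a sequence $(v_n)$ in $B$ with $\|a-v_nbv_n^*\|\to 0$. For self-adjoint $a$ and $\varepsilon>0$, $(a-\varepsilon)_+$ is obtained by applying $t\mapsto\max(t-\varepsilon,0)$ to $a$. $B$ is simple if it has no closed two-sided ideals other than $0$ and $B$. Let $\mathcal C$ be a class of unital C*-algebras. A unital C*-algebra $B$ belongs to $\mathrm{TA}\mathcal C$ ($B$ is tracially approximated by algebras in $\mathcal C$) if for every finite $F\subseteq B$, every $\varepsilon>0$ and every nonzero positive $a\in B$ there are a nonzero projection $p\in B$ and a C*-subalgebra $D\subseteq B$ with unit $p$ and $D\in\mathcal C$ such that $\|px-xp\|<\varepsilon$ for all $x\in F$; for each $x\in F$ there is $d\in D$ with $\|pxp-d\|<\varepsilon$; and $1-p\precsim_B a$. An action $\alpha\colon G\to\mathrm{Aut}(A)$ of a finite group $G$ on a simple unital C*-algebra $A$ has the tracial Rokhlin property if for every finite $F\subseteq A$, every $\varepsilon>0$ and all positive $x,y\in A$ with $\|x\|=1$ there are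 mutually orthogonal projections $(p_g)_{g\in G}$ in $A$ such that, with $p=\sum_{g\in G}p_g$: $\|p_ga-ap_g\|<\varepsilon$ for all $a\in F$ and $g\in G$; $\|\alpha_g(p_h)-p_{gh}\|<\varepsilon$ for all $g,h\in G$; $(y^2-ypy-\varepsilon)_+\precsim_A x$; and $\|pxp\|>1-\varepsilon$. **Theorem.** Let $\mathcal C$ be a class of unital C*-algebras such that: 1. if $A\in\mathcal C$ and $B$ is a C*-algebra with $B\cong A$, then $B\in\mathcal C$; 2. if $A\in\mathcal C$ and $n\ge 1$, then $M_n(A)\in\mathcal C$; 3. if $A\in\mathcal C$ and $p\in A$ is a nonzero projection, then $pAp\in\mathcal C$. Let $A$ be a simple unital C*-algebra with $A\in\mathrm{TA}\mathcal C$, and let $\alpha$ be an action of a finite group $G$ on $A$ with the tracial Rokhlin property. Then the crossed product satisfies $A\rtimes_\alpha G\in\mathrm{TA}\mathcal C$. -/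

import Mathlib

open Filter Topology

universe u v

set_option linter.unusedSectionVars false

noncomputable section

namespace TracialApproximation

section Basic

variable {A : Type u} [CStarAlgebra A]

/-- Positive elements of a C*-algebra: those of the form `b⋆ b`. -/
def IsPositive (a : A) : Prop := ∃ b : A, a = star b * b

/-- Cuntz subequivalence `a ≾ b`: there is a sequence `vₙ` with `‖a - vₙ b vₙ⋆‖ → 0`. -/
def CuntzLE (a b : A) : Prop :=
  ∃ v : ℕ → A, Tendsto (fun n => ‖a - v n * b * star (v n)‖) atTop (𝓝 0)

/-- `(a - ε)₊` for a self-adjoint element `a`, by continuous functional calculus. -/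
def cutDown (a : A) (ε : ℝ) : A := cfc (fun t : ℝ => max (t - ε) 0) a

variable (A) in
/-- Simplicity of a C*-algebra: the only closed two-sided ideals are `0` and the whole algebra. -/
def IsSimple : Prop :=
  ∀ I : TwoSidedIdeal A, IsClosed (I : Set A) → I = ⊥ ∨ I = ⊤

end Basic

/-! ### C*-subalgebras with a unit of their own -/

/-- A C*-subalgebra `D` of `A` (norm closed ⋆-subalgebra) that has a unit, which need not be the
unit of `A`. -/
structure UnitalCStarSubalgebra (A : Type u) [CStarAlgebra A]
    extends NonUnitalStarSubalgebra ℂ A where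
  isClosed' : IsClosed carrier
  unit : A
  unit_mem' : unit ∈ carrier
  unit_mul' : ∀ x ∈ carrier, unit * x = x
  mul_unit' : ∀ x ∈ carrier, x * unit = x

namespace UnitalCStarSubalgebra

variable {A : Type u} [CStarAlgebra A]

/-- The underlying type of a unital C*-subalgebra. -/
abbrev Carrier (D : UnitalCStarSubalgebra A) : Type u := D.toNonUnitalStarSubalgebra

variable (D : UnitalCStarSubalgebra A)

instance : NonUnitalCStarAlgebra D.Carrier :=
  NonUnitalStarSubalgebra.nonUnitalCStarAlgebra D.toNonUnitalStarSubalgebra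
    (h_closed := D.isClosed')

instance : One D.Carrier := ⟨⟨D.unit, D.unit_mem'⟩⟩

instance : NormedRing D.Carrier where
  __ := (inferInstance : NonUnitalNormedRing D.Carrier)
  one_mul x := Subtype.ext (D.unit_mul' x x.2)
  mul_one x := Subtype.ext (D.mul_unit' x x.2)

instance : Algebra ℂ D.Carrier :=
  Algebra.ofModule (fun r x y => smul_mul_assoc r x y) (fun r x y => mul_smul_comm r x y)

instance : NormedAlgebra ℂ D.Carrier where
  norm_smul_le r x := norm_smul_le r x

/-- A C*-subalgebra with a unit is a unital C*-algebra, with the operations and the norm of the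
ambient algebra and with its own unit. -/
instance : CStarAlgebra D.Carrier where
  __ := (inferInstance : NonUnitalCStarAlgebra D.Carrier)
  __ := (inferInstance : NormedRing D.Carrier)
  __ := (inferInstance : NormedAlgebra ℂ D.Carrier)

theorem corner_mul_mul {p : A} (hp : IsStarProjection p) {x : A} (hx : ∃ a, x = p * a * p) :
    p * x = x ∧ x * p = x := by
  obtain ⟨a, rfl⟩ := hx
  have h : p * p = p := hp.isIdempotentElem
  constructor
  · rw [← mul_assoc, ← mul_assoc, h]
  · rw [mul_assoc, h]

/-- The corner `p A p` of a projection `p`, with unit `p`. -/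
def corner (p : A) (hp : IsStarProjection p) : UnitalCStarSubalgebra A where
  carrier := {x | ∃ a, x = p * a * p}
  add_mem' := by
    rintro _ _ ⟨a, rfl⟩ ⟨b, rfl⟩
    exact ⟨a + b, by rw [mul_add, add_mul]⟩
  zero_mem' := ⟨0, by simp⟩
  mul_mem' := by
    rintro _ _ ⟨a, rfl⟩ ⟨b, rfl⟩
    exact ⟨a * p * p * b, by simp only [mul_assoc]⟩
  smul_mem' := by
    rintro c _ ⟨a, rfl⟩
    exact ⟨c • a, by simp⟩
  star_mem' := by
    rintro _ ⟨a, rfl⟩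
    exact ⟨star a, by simp [hp.isSelfAdjoint.star_eq, mul_assoc]⟩
  isClosed' := by
    have : {x : A | ∃ a, x = p * a * p} = {x | p * x * p = x} := by
      ext x
      constructor
      · intro hx
        obtain ⟨h1, h2⟩ := corner_mul_mul hp hx
        change p * x * p = x
        rw [h1, h2]
      · intro hx
        exact ⟨x, Eq.symm hx⟩
    change IsClosed {x : A | ∃ a, x = p * a * p}
    rw [this]
    exact isClosed_eq (by fun_prop) continuous_id
  unit := p
  unit_mem' := ⟨p, by rw [hp.isIdempotentElem, hp.isIdempotentElem]⟩
  unit_mul' _ hx := (corner_mul_mul hp hx).1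
  mul_unit' _ hx := (corner_mul_mul hp hx).2

end UnitalCStarSubalgebra

/-! ### Matrix algebras -/

section MatrixAlgebra

variable (n : Type v) [Fintype n] [DecidableEq n] (A : Type u) [CStarAlgebra A]

/-- `M_n(A)` with the C*-algebra structure of Mathlib. That structure asks for the order of `A`,
which is determined by `A`; we supply it here. -/
@[reducible] def matrixCStarAlgebra : CStarAlgebra (CStarMatrix n n A) :=
  letI : PartialOrder A := CStarAlgebra.spectralOrder A
  letI : StarOrderedRing A := CStarAlgebra.spectralOrderedRing A
  CStarMatrix.instCStarAlgebra

end MatrixAlgebra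

/-! ### Classes of C*-algebras and tracial approximation -/

/-- A class of unital C*-algebras. -/
abbrev CStarClass : Type (u + 1) := ∀ (B : Type u) [CStarAlgebra B], Prop

/-- `A ∈ TA𝒞`: the unital C*-algebra `A` is tracially approximated by algebras in `𝒞`. -/
def TA (𝒞 : CStarClass.{u}) (A : Type u) [CStarAlgebra A] : Prop :=
  ∀ (F : Finset A) (ε : ℝ) (a : A), 0 < ε → IsPositive a → a ≠ 0 →
    ∃ (p : A) (D : UnitalCStarSubalgebra A),
      IsStarProjection p ∧ p ≠ 0 ∧ D.unit = p ∧ 𝒞 D.Carrier ∧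
      (∀ x ∈ F, ‖p * x - x * p‖ < ε) ∧
      (∀ x ∈ F, ∃ d ∈ D.toNonUnitalStarSubalgebra, ‖p * x * p - d‖ < ε) ∧
      CuntzLE (1 - p) a

/-! ### Actions of finite groups -/

section Actions

variable {G : Type v} [Group G] [Fintype G] {A : Type u} [CStarAlgebra A]

/-- The tracial Rokhlin property of an action of a finite group. -/
def HasTracialRokhlinProperty (α : G →* (A ≃⋆ₐ[ℂ] A)) : Prop :=
  ∀ (F : Finset A) (ε : ℝ) (x y : A), 0 < ε → IsPositive x → IsPositive y → ‖x‖ = 1 →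
    ∃ p : G → A,
      (∀ g, IsStarProjection (p g)) ∧
      (∀ g h, g ≠ h → p g * p h = 0) ∧
      (∀ a ∈ F, ∀ g, ‖p g * a - a * p g‖ < ε) ∧
      (∀ g h, ‖α g (p h) - p (g * h)‖ < ε) ∧
      CuntzLE (cutDown (y ^ 2 - y * (∑ g, p g) * y) ε) x ∧
      1 - ε < ‖(∑ g, p g) * x * (∑ g, p g)‖

/-- The crossed product `A ⋊_α G` of a unital C*-algebra by a finite group. Its elements are the
formal sums `∑ a_g u_g`, that is, the functions `g ↦ a_g` from `G` to `A`. -/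
def CrossedProduct (_α : G →* (A ≃⋆ₐ[ℂ] A)) : Type (max u v) := G → A

namespace CrossedProduct

variable {α : G →* (A ≃⋆ₐ[ℂ] A)}

instance : AddCommGroup (CrossedProduct α) := inferInstanceAs (AddCommGroup (G → A))

instance : Module ℂ (CrossedProduct α) := inferInstanceAs (Module ℂ (G → A))

@[ext] theorem ext {x y : CrossedProduct α} (h : ∀ g, x g = y g) : x = y := funext h

@[simp] theorem add_apply (x y : CrossedProduct α) (g : G) : (x + y) g = x g + y g := rfl

@[simp] theorem zero_apply (g : G) : (0 : CrossedProduct α) g = 0 := rfl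

@[simp] theorem smul_apply (c : ℂ) (x : CrossedProduct α) (g : G) : (c • x) g = c • x g := rfl

/-- The product determined by `u_g a = α_g(a) u_g` and `u_g u_h = u_{gh}`. -/
instance : Mul (CrossedProduct α) :=
  ⟨fun x y g => ∑ h, x h * α h (y (h⁻¹ * g))⟩

theorem mul_apply (x y : CrossedProduct α) (g : G) :
    (x * y) g = ∑ h, x h * α h (y (h⁻¹ * g)) := rfl

open Classical in
/-- The unit is `1 u_1`. -/
instance : One (CrossedProduct α) := ⟨fun g => if g = 1 then 1 else 0⟩

open Classical in
theorem one_apply (g : G) : (1 : CrossedProduct α) g = if g = 1 then 1 else 0 := rfl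

/-- The involution, determined by `(a u_g)⋆ = α_{g⁻¹}(a⋆) u_{g⁻¹}`. -/
instance : Star (CrossedProduct α) := ⟨fun x g => α g (star (x g⁻¹))⟩

theorem star_apply (x : CrossedProduct α) (g : G) : (star x) g = α g (star (x g⁻¹)) := rfl

/-- The regular representation `∑ a_g u_g ↦ (α_s⁻¹(a_{s t⁻¹}))_{s,t}` in `M_G(A)`. -/
def regRep (x : CrossedProduct α) : CStarMatrix G G A :=
  CStarMatrix.ofMatrix (fun s t => α s⁻¹ (x (s * t⁻¹)))

theorem regRep_apply (x : CrossedProduct α) (s t : G) :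
    regRep x s t = α s⁻¹ (x (s * t⁻¹)) := rfl

theorem map_mul_apply' (g h : G) (a : A) : α (g * h) a = α g (α h a) := by
  rw [map_mul]; rfl

theorem map_one_apply' (a : A) : α 1 a = a := by
  rw [map_one]; rfl

theorem regRep_injective : Function.Injective (regRep (α := α)) := by
  intro x y h
  ext g
  have := CStarMatrix.ext_iff.2 h 1 g⁻¹
  simpa [regRep_apply, map_one_apply'] using this

theorem regRep_add (x y : CrossedProduct α) : regRep (x + y) = regRep x + regRep y := by
  ext s t
  simp [regRep_apply]

theorem regRep_zero : regRep (0 : CrossedProduct α) = 0 := by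
  ext s t
  simp [regRep_apply]

theorem regRep_smul (c : ℂ) (x : CrossedProduct α) : regRep (c • x) = c • regRep x := by
  ext s t
  simp [regRep_apply]

theorem regRep_mul (x y : CrossedProduct α) : regRep (x * y) = regRep x * regRep y := by
  ext s t
  rw [regRep_apply, CStarMatrix.mul_apply, mul_apply, map_sum]
  refine Fintype.sum_equiv ((Equiv.inv G).trans (Equiv.mulRight s)) _ _ (fun h => ?_)
  simp only [Equiv.trans_apply, Equiv.inv_apply, Equiv.coe_mulRight, regRep_apply, map_mul,
    mul_inv_rev, inv_inv, ← map_mul_apply']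
  simp [mul_assoc]

open Classical in
theorem regRep_one : regRep (1 : CrossedProduct α) = 1 := by
  ext s t
  rw [regRep_apply, one_apply, CStarMatrix.one_apply]
  by_cases h : s = t
  · simp [h]
  · simp [h, mul_inv_eq_one]

theorem regRep_star (x : CrossedProduct α) : regRep (star x) = star (regRep x) := by
  ext s t
  rw [regRep_apply, CStarMatrix.star_apply, star_apply, regRep_apply, ← map_mul_apply', ← map_star]
  simp

instance : Ring (CrossedProduct α) where
  __ := (inferInstance : AddCommGroup (CrossedProduct α))
  mul_assoc x y z := regRep_injective (by simp only [regRep_mul, mul_assoc])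
  left_distrib x y z := regRep_injective (by simp only [regRep_mul, regRep_add, mul_add])
  right_distrib x y z := regRep_injective (by simp only [regRep_mul, regRep_add, add_mul])
  zero_mul x := regRep_injective (by simp only [regRep_mul, regRep_zero, zero_mul])
  mul_zero x := regRep_injective (by simp only [regRep_mul, regRep_zero, mul_zero])
  one_mul x := by
    classical exact regRep_injective (by rw [regRep_mul, regRep_one, one_mul])
  mul_one x := by
    classical exact regRep_injective (by rw [regRep_mul, regRep_one, mul_one])

instance : StarRing (CrossedProduct α) where
  star_involutive x := regRep_injective (by simp only [regRep_star, star_star])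
  star_mul x y := regRep_injective (by simp only [regRep_star, regRep_mul, star_mul])
  star_add x y := regRep_injective (by simp only [regRep_star, regRep_add, star_add])

instance : StarModule ℂ (CrossedProduct α) where
  star_smul c x := regRep_injective (by simp only [regRep_star, regRep_smul, star_smul])

instance : Algebra ℂ (CrossedProduct α) :=
  Algebra.ofModule
    (fun r x y => regRep_injective (by
      rw [regRep_smul, regRep_mul, regRep_mul, regRep_smul]; exact CStarMatrix.smul_mul _ _ _))
    (fun r x y => regRep_injective (by
      rw [regRep_smul, regRep_mul, regRep_mul, regRep_smul]; exact CStarMatrix.mul_smul _ _ _))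

open Classical in
/-- The regular representation as a unital ⋆-homomorphism. -/
def regRepHom (α : G →* (A ≃⋆ₐ[ℂ] A)) : CrossedProduct α →⋆ₐ[ℂ] CStarMatrix G G A where
  toFun := regRep
  map_one' := regRep_one
  map_mul' := regRep_mul
  map_zero' := regRep_zero
  map_add' := regRep_add
  commutes' r := by
    rw [Algebra.algebraMap_eq_smul_one, regRep_smul, regRep_one, Algebra.algebraMap_eq_smul_one]
  map_star' := regRep_star

open Classical in
/-- The norm is the one of the regular representation in `M_G(A)`. -/
instance : NormedRing (CrossedProduct α) :=
  letI := matrixCStarAlgebra G A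
  NormedRing.induced (CrossedProduct α) (CStarMatrix G G A) (regRepHom α) regRep_injective

open Classical in
theorem norm_def (x : CrossedProduct α) :
    ‖x‖ = (letI := matrixCStarAlgebra G A; ‖regRep x‖) := rfl

open Classical in
instance : NormedAlgebra ℂ (CrossedProduct α) where
  norm_smul_le r x := by
    let _ := matrixCStarAlgebra G A
    rw [norm_def, norm_def, regRep_smul]
    exact norm_smul_le r (regRep x)

open Classical in
instance : CStarRing (CrossedProduct α) where
  norm_mul_self_le x := by
    let _ := matrixCStarAlgebra G A
    rw [norm_def, norm_def, regRep_mul, regRep_star]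
    exact CStarRing.norm_mul_self_le (regRep x)

theorem range_regRep : Set.range (regRep (α := α)) =
    {M : CStarMatrix G G A | ∀ s t, M s t = α s⁻¹ (M 1 (t * s⁻¹))} := by
  ext M
  constructor
  · rintro ⟨x, rfl⟩ s t
    simp [regRep_apply]
  · intro hM
    refine ⟨fun g => M 1 g⁻¹, ?_⟩
    ext s t
    refine Eq.trans ?_ (hM s t).symm
    change α s⁻¹ (M 1 (s * t⁻¹)⁻¹) = _
    rw [mul_inv_rev, inv_inv]

open Classical in
instance : CompleteSpace (CrossedProduct α) := by
  let _ := matrixCStarAlgebra G A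
  have hu : IsUniformInducing (regRep (α := α)) := ⟨rfl⟩
  refine hu.completeSpace (IsClosed.isComplete ?_)
  have hc : ∀ s t : G, Continuous fun M : CStarMatrix G G A => M s t := fun s t =>
    (continuous_apply t).comp (continuous_apply (A := fun _ : G => G → A) s)
  rw [range_regRep, Set.ofPred_forall]
  refine isClosed_iInter fun s => ?_
  rw [Set.ofPred_forall]
  exact isClosed_iInter fun t => isClosed_eq (hc s t)
    ((StarAlgEquiv.isometry (α s⁻¹)).continuous.comp
      (hc 1 (t * s⁻¹)))

instance : CStarAlgebra (CrossedProduct α) where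

end CrossedProduct

end Actions

end TracialApproximation

end

/-!
The crossed product of a simple algebra in `TA𝒞` by a finite group action with the tracial Rokhlin
property is again in `TA𝒞`, because Rokhlin projections make it look like a matrix algebra over a
corner of the coefficient algebra.

Let `p_g` be Rokhlin projections and `q` the unit of an approximating subalgebra `D ⊆ A` that almost
commutes with `p_1`. Then `D` contains a projection `r` close to `q p_1` (`TA.exists_corner`).
Simplicity of `A` is what prevents `q p_1` from vanishing: a projection that almost commutes with
enough elements cannot almost annihilate a given nonzero element (`IsSimple.exists_le_norm_mul`).
Since `u_g p_1 u_g⋆` is close to `p_g`, the elements `u_g r` are almost partial isometries with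
orthogonal ranges. Putting `w_g = p_g u_g s_g`, where `s_g` is the inverse square root of
`r α_{g⁻¹}(p_g) r` in `r A r`, makes the ranges orthogonal and the initial projections equal to `r`
(`exists_partialIsometries`). So the `w_g` and `r D r` generate a copy of `M_n(r D r)`, `n = |G|`
(`exists_subalgebra_of_matrixUnits`), with unit `∑ w_g w_g⋆`; this is the subalgebra sought. The
approximate identities are proved as exact ones in the algebra `SeqAlg` of bounded sequences modulo
null sequences, where `w_g` becomes `u_g r`.

The defect `1 - ∑ w_g w_g⋆` is the orthogonal sum of `1 - ∑ p_g` and the projections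
`p_g - w_g w_g⋆`, each of which is close to a conjugate of a compression of `1 - q`. All of them are
to fit under one positive element `a` of the crossed product
(`exists_isRokhlinFamily_cuntzLE`). Compressing `a` by a Rokhlin projection gives nearly its
coefficient at `1`, hence a nonzero element of `A` below `a` (`exists_cuntzLE_incl`); compressing
that by two Rokhlin projections splits it (`exists_pair_cuntzLE`), and simplicity provides a common
minorant of the pieces. Only projections are ever compared with these elements, and for those an
error of `1 / 2` in Cuntz subequivalence is harmless (`IsStarProjection.cuntzLE_of_norm_le`).
-/

namespace TracialApproximation

/-! ### Functional calculus and projections -/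

section Calculus

variable {A : Type*} [CStarAlgebra A]

/-- The inverse square root of a self-adjoint element `t` near `1`. For `t` far from `1` nothing is
asserted beyond the bound, so that sequences of such elements can be handled without case
distinctions. -/
theorem exists_inv_sqrt {t : A} (ht : IsSelfAdjoint t) :
    ∃ s : A, IsSelfAdjoint s ∧ ‖s - 1‖ ≤ ‖t - 1‖ ∧ (∀ y, Commute t y → Commute s y) ∧
      (‖t - 1‖ ≤ 1 / 2 → s * t * s = 1) := by
  by_cases h : ‖t - 1‖ ≤ 1 / 2
  swap
  · exact ⟨1, .one A, by simp, fun y _ => Commute.one_left y, fun h' => absurd h' h⟩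
  have hspec : ∀ x ∈ spectrum ℝ t, |x - 1| ≤ ‖t - 1‖ := by
    intro x hx
    have h1 : cfc (fun x : ℝ => x - 1) t = t - 1 := by
      rw [cfc_sub (fun x => x) (fun _ => (1 : ℝ)) t, cfc_id' ℝ t, cfc_const_one ℝ t]
    have := norm_apply_le_norm_cfc (fun x : ℝ => x - 1) t hx
    rwa [h1] at this
  have hpos : ∀ x ∈ spectrum ℝ t, 1 / 2 ≤ x := fun x hx => by
    have := abs_le.1 ((hspec x hx).trans h)
    linarith [this.1]
  have hc : ContinuousOn (fun x : ℝ => (√x)⁻¹) (spectrum ℝ t) :=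
    Real.continuous_sqrt.continuousOn.inv₀ fun x hx =>
      (Real.sqrt_pos.2 (by linarith [hpos x hx])).ne'
  refine ⟨cfc (fun x : ℝ => (√x)⁻¹) t, cfc_predicate _ _, ?_,
    fun y hy => hy.cfc_real _, fun _ => ?_⟩
  · have h1 : cfc (fun x : ℝ => (√x)⁻¹ - 1) t = cfc (fun x : ℝ => (√x)⁻¹) t - 1 := by
      rw [cfc_sub (fun x : ℝ => (√x)⁻¹) (fun _ => (1 : ℝ)) t, cfc_const_one ℝ t]
    rw [← h1]
    refine norm_cfc_le (norm_nonneg _) fun x hx => ?_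
    refine le_trans ?_ (hspec x hx)
    have hx0 := hpos x hx
    set r := √x with hr
    have hrx : x = r * r := (Real.mul_self_sqrt (by linarith)).symm
    have hr0 : 1 / 2 < r := by
      rw [hr]; exact (Real.lt_sqrt (by norm_num)).2 (by norm_num; linarith)
    have h2 : r⁻¹ - 1 = (1 - x) * (r * (1 + r))⁻¹ := by
      rw [hrx]; field_simp; ring
    have h3 : 1 ≤ r * (1 + r) := by nlinarith
    rw [h2, norm_mul, Real.norm_eq_abs, abs_sub_comm]
    refine mul_le_of_le_one_right (abs_nonneg _) ?_
    rw [norm_inv, Real.norm_eq_abs, abs_of_pos (by linarith)]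
    exact inv_le_one_of_one_le₀ h3
  · nth_rewrite 2 [← cfc_id' ℝ t]
    rw [← cfc_mul _ _ t, ← cfc_mul _ _ t, ← cfc_const_one ℝ t]
    refine cfc_congr fun x hx => ?_
    have hx0 : 0 < √x := Real.sqrt_pos.2 (by linarith [hpos x hx])
    have := Real.mul_self_sqrt (show 0 ≤ x by linarith [hpos x hx])
    calc (√x)⁻¹ * x * (√x)⁻¹ = (√x)⁻¹ * (√x * √x) * (√x)⁻¹ := by rw [this]
      _ = 1 := by field_simp

/-- An approximately idempotent self-adjoint element is close to a projection. -/
theorem exists_isStarProjection_near {d : A} (hd : IsSelfAdjoint d) {η : ℝ} (hη : η ≤ 1 / 10)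
    (h : ‖d * d - d‖ ≤ η) : ∃ r : A, IsStarProjection r ∧ ‖r - d‖ ≤ 2 * η := by
  have hη0 : 0 ≤ η := (norm_nonneg _).trans h
  have hspec : ∀ x ∈ spectrum ℝ d, |x * x - x| ≤ η := by
    intro x hx
    have h1 : cfc (fun x : ℝ => x * x - x) d = d * d - d := by
      rw [cfc_sub (fun x => x * x) (fun x : ℝ => x) d, cfc_mul (fun x => x) (fun x => x) d,
        cfc_id' ℝ d]
    have := norm_apply_le_norm_cfc (fun x : ℝ => x * x - x) d hx
    rw [h1] at this
    exact this.trans h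
  -- the spectrum clusters at `0` and `1`, and `f` takes these values near the two points
  let f : ℝ → ℝ := fun x => max 0 (min 1 (2 * x - 1 / 2))
  have hfc : Continuous f := by fun_prop
  have hcase : ∀ x ∈ spectrum ℝ d,
      (f x = 0 ∧ |x| ≤ 2 * η) ∨ (f x = 1 ∧ |1 - x| ≤ 2 * η) := by
    intro x hx
    have h1 := abs_le.1 (hspec x hx)
    by_cases hx1 : x ≤ 1 / 4
    · left
      refine ⟨by simp only [f]; rw [max_eq_left]; exact min_le_of_right_le (by linarith), ?_⟩
      rw [abs_le]; constructor <;> nlinarith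
    · have hx2 : 3 / 4 ≤ x := by by_contra hh; nlinarith
      right
      refine ⟨by simp only [f]; rw [min_eq_left (by linarith), max_eq_right (by norm_num)], ?_⟩
      rw [abs_le]; constructor <;> nlinarith
  refine ⟨cfc f d, ⟨?_, cfc_predicate _ _⟩, ?_⟩
  · rw [IsIdempotentElem, ← cfc_mul _ _ d]
    refine cfc_congr fun x hx => ?_
    rcases hcase x hx with ⟨h1, -⟩ | ⟨h1, -⟩ <;> simp [h1]
  · have h1 : cfc (fun x => f x - x) d = cfc f d - d := by
      rw [cfc_sub f (fun x : ℝ => x) d, cfc_id' ℝ d]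
    rw [← h1]
    refine norm_cfc_le (by linarith) fun x hx => ?_
    rcases hcase x hx with ⟨h1, h2⟩ | ⟨h1, h2⟩ <;> simpa [h1] using h2

/-- Spectral cutoffs of a positive element `z` at height `κ`. With `l = (z - κ)₊` and
`m = min(z, κ)`, the element `l z l` has the square root `h`, and `k` is a bounded substitute for
`z^{-1/2}` on the part of the spectrum where `l` lives. -/
theorem exists_cutoff {z : A} (hz : IsPositive z) {κ : ℝ} (hκ : 0 < κ) :
    ∃ h k l m : A, IsSelfAdjoint h ∧ IsSelfAdjoint l ∧ (∀ y, Commute z y → Commute h y) ∧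
      l * z * l = h * h ∧ h * k = l ∧ z = l + m ∧ ‖m‖ ≤ κ ∧ ‖k‖ * ‖k‖ ≤ κ⁻¹ := by
  have hzs : IsSelfAdjoint z := by
    obtain ⟨b, rfl⟩ := hz; exact .star_mul_self b
  have hz0 : ∀ x ∈ spectrum ℝ z, 0 ≤ x := by
    obtain ⟨b, rfl⟩ := hz
    exact fun x hx => spectrum_star_mul_self_nonneg x hx
  let l : ℝ → ℝ := fun x => max (x - κ) 0
  let k : ℝ → ℝ := fun x => (√(max x κ))⁻¹
  let h : ℝ → ℝ := fun x => l x * √x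
  let m : ℝ → ℝ := fun x => min x κ
  have hl : Continuous l := by fun_prop
  have hm : Continuous m := by fun_prop
  have hh : Continuous h := by fun_prop
  have hk0 : ∀ x, √(max x κ) ≠ 0 := fun x => (Real.sqrt_pos.2 (lt_max_of_lt_right hκ)).ne'
  have hk : Continuous k := Continuous.inv₀ (by fun_prop) hk0
  refine ⟨cfc h z, cfc k z, cfc l z, cfc m z, cfc_predicate _ _, cfc_predicate _ _,
    fun y hy => hy.cfc_real _, ?_, ?_, ?_, ?_, ?_⟩
  · nth_rewrite 2 [← cfc_id' ℝ z]
    rw [← cfc_mul l (fun x => x) z hl.continuousOn continuousOn_id,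
      ← cfc_mul (fun x => l x * x) l z (hl.mul continuous_id).continuousOn hl.continuousOn,
      ← cfc_mul h h z hh.continuousOn hh.continuousOn]
    refine cfc_congr fun x hx => ?_
    simp only [h]
    linear_combination -(l x * l x) * Real.mul_self_sqrt (hz0 x hx)
  · rw [← cfc_mul h k z hh.continuousOn hk.continuousOn]
    refine cfc_congr fun x hx => ?_
    simp only [h, k]
    rcases le_total x κ with hx1 | hx1
    · have : l x = 0 := max_eq_right (by linarith)
      simp [this]
    · rw [max_eq_left hx1, mul_assoc, mul_inv_cancel₀, mul_one]
      exact (Real.sqrt_pos.2 (by linarith)).ne'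
  · rw [← cfc_add z l m hl.continuousOn hm.continuousOn]
    conv_lhs => rw [← cfc_id' ℝ z]
    refine cfc_congr fun x hx => ?_
    simp only [l, m]
    rcases le_total x κ with hx1 | hx1
    · rw [max_eq_right (by linarith), min_eq_left hx1]; ring
    · rw [max_eq_left (by linarith), min_eq_right hx1]; ring
  · refine norm_cfc_le hκ.le fun x hx => ?_
    rw [Real.norm_eq_abs, abs_of_nonneg (le_min (hz0 x hx) hκ.le)]
    exact min_le_right _ _
  · have : ‖cfc k z‖ ≤ (√κ)⁻¹ := by
      refine norm_cfc_le (by positivity) fun x hx => ?_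
      rw [Real.norm_eq_abs, abs_of_nonneg (by positivity)]
      exact inv_anti₀ (Real.sqrt_pos.2 hκ) (Real.sqrt_le_sqrt (le_max_right _ _))
    calc _ ≤ (√κ)⁻¹ * (√κ)⁻¹ := by gcongr
      _ = κ⁻¹ := by rw [← mul_inv, Real.mul_self_sqrt hκ.le]

theorem isPositive_iff_nonneg [PartialOrder A] [StarOrderedRing A] {a : A} :
    IsPositive a ↔ 0 ≤ a :=
  CStarAlgebra.nonneg_iff_eq_star_mul_self.symm

theorem IsPositive.isSelfAdjoint {a : A} (ha : IsPositive a) : IsSelfAdjoint a := by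
  obtain ⟨b, rfl⟩ := ha; exact .star_mul_self b

theorem IsPositive.add {a b : A} (ha : IsPositive a) (hb : IsPositive b) :
    IsPositive (a + b) := by
  let _ := CStarAlgebra.spectralOrder A
  have := CStarAlgebra.spectralOrderedRing A
  rw [isPositive_iff_nonneg] at *
  exact add_nonneg ha hb

theorem IsPositive.conj {a : A} (ha : IsPositive a) (v : A) : IsPositive (star v * a * v) := by
  obtain ⟨b, rfl⟩ := ha
  exact ⟨b * v, by simp [mul_assoc]⟩

theorem IsPositive.map {B : Type*} [CStarAlgebra B] {a : A} (ha : IsPositive a)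
    (φ : A →⋆ₐ[ℂ] B) : IsPositive (φ a) := by
  obtain ⟨b, rfl⟩ := ha
  exact ⟨φ b, by rw [map_mul, map_star φ b]⟩

theorem IsPositive.exists_sqrt {a : A} (ha : IsPositive a) :
    ∃ r : A, IsSelfAdjoint r ∧ a = r * r := by
  have hs := ha.isSelfAdjoint
  refine ⟨cfc Real.sqrt a, cfc_predicate _ _, ?_⟩
  rw [← cfc_mul _ _ a]
  conv_lhs => rw [← cfc_id' ℝ a]
  obtain ⟨b, rfl⟩ := ha
  exact cfc_congr fun x hx => (Real.mul_self_sqrt (spectrum_star_mul_self_nonneg x hx)).symm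

theorem IsStarProjection.norm_eq_one {p : A} (hp : IsStarProjection p) (h0 : p ≠ 0) :
    ‖p‖ = 1 := by
  have h := CStarRing.norm_star_mul_self (x := p)
  rw [hp.isSelfAdjoint.star_eq, hp.isIdempotentElem.eq] at h
  have : ‖p‖ ≠ 0 := norm_ne_zero_iff.2 h0
  field_simp at h
  exact h.symm

theorem IsStarProjection.norm_le_one {p : A} (hp : IsStarProjection p) : ‖p‖ ≤ 1 := by
  rcases eq_or_ne p 0 with rfl | h
  · simp
  · exact (IsStarProjection.norm_eq_one hp h).le

end Calculus

/-! ### Cuntz subequivalence -/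

section Cuntz

variable {A : Type*} [CStarAlgebra A]

theorem cuntzLE_iff {a b : A} :
    CuntzLE a b ↔ ∀ ε : ℝ, 0 < ε → ∃ v : A, ‖a - v * b * star v‖ < ε := by
  constructor
  · rintro ⟨v, hv⟩ ε hε
    obtain ⟨n, hn⟩ := (hv.eventually (gt_mem_nhds hε)).exists
    exact ⟨v n, hn⟩
  · intro h
    choose v hv using fun n : ℕ => h (1 / (n + 1)) (by positivity)
    exact ⟨v, squeeze_zero (fun _ => norm_nonneg _) (fun n => (hv n).le)
      tendsto_one_div_add_atTop_nhds_zero_nat⟩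

theorem CuntzLE.of_eq {a b : A} (v : A) (h : a = v * b * star v) : CuntzLE a b :=
  cuntzLE_iff.2 fun ε hε => ⟨v, by rwa [h, sub_self, norm_zero]⟩

theorem CuntzLE.zero (b : A) : CuntzLE 0 b := .of_eq 0 (by simp)

theorem CuntzLE.trans {a b c : A} (hab : CuntzLE a b) (hbc : CuntzLE b c) : CuntzLE a c := by
  rw [cuntzLE_iff] at *
  intro ε hε
  obtain ⟨v, hv⟩ := hab (ε / 2) (by positivity)
  obtain ⟨w, hw⟩ := hbc (ε / 2 / (‖v‖ * ‖v‖ + 1)) (by positivity)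
  refine ⟨v * w, ?_⟩
  have h1 : a - v * w * c * star (v * w) =
      (a - v * b * star v) + v * (b - w * c * star w) * star v := by
    rw [star_mul]; noncomm_ring
  have h2 : ‖v * (b - w * c * star w) * star v‖ ≤ ε / 2 := by
    calc _ ≤ ‖v‖ * ‖b - w * c * star w‖ * ‖star v‖ := norm_mul₃_le
      _ = ‖b - w * c * star w‖ * (‖v‖ * ‖v‖) := by rw [norm_star]; ring
      _ ≤ ε / 2 / (‖v‖ * ‖v‖ + 1) * (‖v‖ * ‖v‖ + 1) := by gcongr; linarith
      _ = ε / 2 := by field_simp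
  rw [h1]
  linarith [norm_add_le (a - v * b * star v) (v * (b - w * c * star w) * star v)]

theorem CuntzLE.map {B : Type*} [CStarAlgebra B] {a b : A} (h : CuntzLE a b)
    (φ : A →⋆ₐ[ℂ] B) : CuntzLE (φ a) (φ b) := by
  rw [cuntzLE_iff] at *
  intro ε hε
  obtain ⟨v, hv⟩ := h ε hε
  refine ⟨φ v, lt_of_le_of_lt ?_ hv⟩
  have := NonUnitalStarAlgHom.norm_apply_le φ (a - v * b * star v)
  rwa [map_sub, map_mul, map_mul, map_star φ v] at this

/-- A scalar multiple by a positive number does not change the Cuntz class. -/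
theorem CuntzLE.of_smul {a b : A} {r : ℝ} (hr : 0 < r) (h : CuntzLE ((r : ℂ) • a) b) :
    CuntzLE a b := by
  refine CuntzLE.trans (.of_eq ((((√r)⁻¹ : ℝ) : ℂ) • (1 : A)) ?_) h
  have h1 : (√r)⁻¹ * ((√r)⁻¹ * r) = 1 := by
    have h2 : √r ≠ 0 := (Real.sqrt_pos.2 hr).ne'
    calc (√r)⁻¹ * ((√r)⁻¹ * r) = (√r)⁻¹ * ((√r)⁻¹ * (√r * √r)) := by
          rw [Real.mul_self_sqrt hr.le]
      _ = 1 := by field_simp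
  have h3 : (((√r)⁻¹ : ℝ) : ℂ) * ((((√r)⁻¹ : ℝ) : ℂ) * (r : ℂ)) = 1 := by exact_mod_cast h1
  rw [star_smul, star_one, smul_mul_assoc, one_mul, mul_smul_comm, mul_one, RCLike.star_def,
    Complex.conj_ofReal, smul_smul, smul_smul, mul_assoc, h3, one_smul]

/-- For projections, approximate subequivalence with error at most `1 / 2` is enough. -/
theorem IsStarProjection.cuntzLE_of_norm_le {x a v : A} (hx : IsStarProjection x)
    (ha : IsSelfAdjoint a) (h : ‖x - v * a * star v‖ ≤ 1 / 2) : CuntzLE x a := by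
  have hxx : x * x = x := hx.isIdempotentElem.eq
  have hxs : star x = x := hx.isSelfAdjoint.star_eq
  set y := x * (v * a * star v) * x with hy
  set t := y + (1 - x) with ht
  have hys : IsSelfAdjoint y := by
    rw [IsSelfAdjoint, hy]; simp [hxs, ha.star_eq, mul_assoc]
  have hts : IsSelfAdjoint t := hys.add ((IsSelfAdjoint.one A).sub hx.isSelfAdjoint)
  have hxy : x * y = y := by rw [hy, ← mul_assoc, ← mul_assoc, hxx]
  have hyx : y * x = y := by rw [hy, mul_assoc, hxx]
  have htn : ‖t - 1‖ ≤ 1 / 2 := by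
    have h1 : t - 1 = -(x * (x - v * a * star v) * x) := by
      rw [ht, mul_sub, sub_mul, hxx, hxx, ← hy]; abel
    rw [h1, norm_neg]
    calc _ ≤ ‖x‖ * ‖x - v * a * star v‖ * ‖x‖ := norm_mul₃_le
      _ ≤ 1 * (1 / 2) * 1 := by
        have := IsStarProjection.norm_le_one hx
        gcongr
      _ = _ := by norm_num
  obtain ⟨s, hs, -, hcomm, hsts⟩ := exists_inv_sqrt hts
  have hsx : Commute s x := hcomm x (by
    rw [Commute, SemiconjBy, ht, add_mul, mul_add, hxy, hyx, sub_mul, mul_sub, hxx]; simp)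
  refine .of_eq (s * x * v) ?_
  have htx : x * t * x = y := by
    rw [ht, mul_add, add_mul, mul_sub, hxx, mul_one, sub_self, zero_mul, add_zero, hxy, hyx]
  calc x = x * (s * t * s) * x := by rw [hsts htn, mul_one, hxx]
    _ = s * (x * t * x) * s := by
      rw [mul_assoc s t s, ← mul_assoc x s, ← hsx.eq, mul_assoc, mul_assoc, mul_assoc, mul_assoc,
        hsx.eq]
      simp only [mul_assoc]
    _ = _ := by
      rw [htx, hy]; simp [hxs, hs.star_eq, mul_assoc]

end Cuntz

/-! ### Cuntz comparison with cutoffs of positive elements -/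

section Cutoff

variable {A : Type*} [CStarAlgebra A]

/-- A positive element `z` has a cutoff `c` that is Cuntz below every element of which `z` is
approximately a compression, as far as projections are concerned. It survives multiplication by
projections on which `z` is larger than `κ`. This replaces Rørdam's lemma on `(z - κ)₊`. -/
theorem exists_cutoff_cuntzLE {B : Type*} [CStarAlgebra B] (φ : A →⋆ₐ[ℂ] B) {z : A}
    (hz : IsPositive z) {κ : ℝ} (hκ : 0 < κ) :
    ∃ c : A, IsPositive c ∧ (∀ y, Commute z y → Commute c y) ∧
      (∀ p, IsStarProjection p → κ < ‖z * p‖ → c * p ≠ 0) ∧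
      ∀ a P x : B, IsSelfAdjoint a → IsSelfAdjoint P → ‖P * a * P - φ z‖ ≤ κ / 8 →
        IsStarProjection x → CuntzLE x (φ c) → CuntzLE x a := by
  obtain ⟨h, k, l, m, hh, hl, hcomm, hlzl, hhk, hzlm, hm, hk⟩ := exists_cutoff hz hκ
  refine ⟨h * h, ⟨h, by rw [hh.star_eq]⟩, fun y hy => (hcomm y hy).mul_left (hcomm y hy), ?_, ?_⟩
  · -- if `c p = 0`, then `z p = min(z, κ) p` has norm at most `κ`
    intro p hp hzp hcp
    have hhp : h * p = 0 := by
      rw [← CStarRing.star_mul_self_eq_zero_iff, star_mul, hh.star_eq, mul_assoc, ← mul_assoc h,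
        hcp, mul_zero]
    have hlp : l * p = 0 := by
      have : star k * h = l := by
        rw [← hl.star_eq, ← hhk, star_mul, hh.star_eq]
      rw [← this, mul_assoc, hhp, mul_zero]
    have h1 : z * p = m * p := by
      rw [hzlm, add_mul, hlp, zero_add]
    have h2 : ‖m * p‖ ≤ κ * 1 :=
      (norm_mul_le _ _).trans (mul_le_mul hm (IsStarProjection.norm_le_one hp) (norm_nonneg _)
        hκ.le)
    rw [h1] at hzp
    linarith
  · intro a P x ha hP hPa hx hxc
    obtain ⟨v, hv⟩ := cuntzLE_iff.1 hxc (1 / 4) (by norm_num)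
    have hφh : star (φ h) = φ h := by rw [← map_star φ h, hh.star_eq]
    have hφl : star (φ l) = φ l := by rw [← map_star φ l, hl.star_eq]
    -- `v h` is bounded since `(v h)(v h)⋆` is close to the projection `x`; hence so is `v l = v h k`
    have hvh : ‖v * φ h‖ * ‖v * φ h‖ ≤ 2 := by
      have h1 : v * φ (h * h) * star v = v * φ h * star (v * φ h) := by
        rw [star_mul, hφh, map_mul]; simp only [mul_assoc]
      rw [h1] at hv
      rw [← CStarRing.norm_self_mul_star]
      have h2 := norm_sub_norm_le (v * φ h * star (v * φ h)) x
      rw [norm_sub_rev] at h2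
      linarith [IsStarProjection.norm_le_one hx]
    have hvl : ‖v * φ l‖ * ‖v * φ l‖ ≤ 2 * κ⁻¹ := by
      have h1 : ‖v * φ l‖ ≤ ‖v * φ h‖ * ‖k‖ := by
        rw [← hhk, map_mul, ← mul_assoc]
        exact (norm_mul_le _ _).trans
          (mul_le_mul_of_nonneg_left (NonUnitalStarAlgHom.norm_apply_le φ k) (norm_nonneg _))
      calc _ ≤ (‖v * φ h‖ * ‖k‖) * (‖v * φ h‖ * ‖k‖) := by gcongr
        _ = (‖v * φ h‖ * ‖v * φ h‖) * (‖k‖ * ‖k‖) := by ring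
        _ ≤ 2 * κ⁻¹ := by gcongr
    refine IsStarProjection.cuntzLE_of_norm_le (v := v * φ l * P) hx ha ?_
    have h1 : x - v * φ l * P * a * star (v * φ l * P) =
        (x - v * φ (h * h) * star v) - v * φ l * (P * a * P - φ z) * star (v * φ l) := by
      rw [← hlzl]
      simp only [star_mul, hφl, hP.star_eq, map_mul]
      noncomm_ring
    have h2 : ‖v * φ l * (P * a * P - φ z) * star (v * φ l)‖ ≤ 1 / 4 := by
      calc _ ≤ ‖v * φ l‖ * ‖P * a * P - φ z‖ * ‖star (v * φ l)‖ := norm_mul₃_le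
        _ = ‖v * φ l‖ * ‖v * φ l‖ * ‖P * a * P - φ z‖ := by rw [norm_star]; ring
        _ ≤ 2 * κ⁻¹ * (κ / 8) := by gcongr
        _ = 1 / 4 := by field_simp; norm_num
    rw [h1]
    linarith [norm_sub_le (x - v * φ (h * h) * star v)
      (v * φ l * (P * a * P - φ z) * star (v * φ l))]

/-- Cuntz subequivalences add up when the right-hand sides are cut out of one element by mutually
orthogonal projections commuting with it. -/
theorem CuntzLE.add_of_orthogonal {B : Type*} [CStarAlgebra B] {c p q x y : B}
    (hp : IsStarProjection p) (hq : IsStarProjection q) (hpq : p * q = 0)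
    (hcp : Commute c p) (hcq : Commute c q) (hx : CuntzLE x (c * p)) (hy : CuntzLE y (c * q)) :
    CuntzLE (x + y) c := by
  have hqp : q * p = 0 := by
    rw [← star_inj, star_mul, hp.isSelfAdjoint.star_eq, hq.isSelfAdjoint.star_eq, hpq, star_zero]
  rw [cuntzLE_iff] at *
  intro ε hε
  obtain ⟨v, hv⟩ := hx (ε / 2) (by positivity)
  obtain ⟨w, hw⟩ := hy (ε / 2) (by positivity)
  refine ⟨v * p + w * q, ?_⟩
  have h1 : p * c * p = c * p := by rw [← hcp.eq, mul_assoc, hp.isIdempotentElem.eq]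
  have h2 : q * c * q = c * q := by rw [← hcq.eq, mul_assoc, hq.isIdempotentElem.eq]
  have h3 : p * c * q = 0 := by rw [← hcp.eq, mul_assoc, hpq, mul_zero]
  have h4 : q * c * p = 0 := by rw [← hcq.eq, mul_assoc, hqp, mul_zero]
  have h5 : x + y - (v * p + w * q) * c * star (v * p + w * q) =
      (x - v * (c * p) * star v) + (y - w * (c * q) * star w) := by
    have h6 : (v * p + w * q) * c * star (v * p + w * q) =
        v * (p * c * p) * star v + v * (p * c * q) * star w + w * (q * c * p) * star v
          + w * (q * c * q) * star w := by
      simp only [star_add, star_mul, hp.isSelfAdjoint.star_eq, hq.isSelfAdjoint.star_eq]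
      noncomm_ring
    rw [h6, h1, h2, h3, h4]
    noncomm_ring
  rw [h5]
  linarith [norm_add_le (x - v * (c * p) * star v) (y - w * (c * q) * star w)]

/-- Cutting down a projection rescales it. -/
theorem IsStarProjection.cutDown_eq {p : A} (hp : IsStarProjection p) {ε : ℝ} (h0 : 0 < ε)
    (h1 : ε < 1) : cutDown p ε = ((1 - ε : ℝ) : ℂ) • p := by
  have hs := hp.isSelfAdjoint
  have h2 : cfc (fun t : ℝ => (1 - ε) * t) p = (1 - ε) • p := by
    rw [cfc_const_mul_id (1 - ε) p]
  rw [cutDown, Complex.coe_smul, ← h2]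
  refine cfc_congr fun t ht => ?_
  rcases IsIdempotentElem.spectrum_subset ℝ hp.isIdempotentElem ht with rfl | rfl
  · simpa using h0.le
  · simpa using h1.le

end Cutoff

/-! ### Simple C*-algebras -/

section Simple

variable {A : Type*} [CStarAlgebra A]

/-- In a simple unital C*-algebra every nonzero element generates `1` algebraically. -/
theorem IsSimple.exists_list_sum_eq_one (hA : IsSimple A) {b : A} (hb : b ≠ 0) :
    ∃ L : List (A × A), (L.map fun p => p.1 * b * p.2).sum = 1 := by
  let S : Set A := {z | ∃ L : List (A × A), (L.map fun p => p.1 * b * p.2).sum = z}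
  have hadd : ∀ x ∈ S, ∀ y ∈ S, x + y ∈ S := by
    rintro _ ⟨L, rfl⟩ _ ⟨L', rfl⟩
    exact ⟨L ++ L', by simp⟩
  have hl : ∀ (x y : A), y ∈ S → x * y ∈ S := by
    rintro x _ ⟨L, rfl⟩
    exact ⟨L.map fun p => (x * p.1, p.2), by
      rw [← List.sum_map_mul_left, List.map_map]; simp [Function.comp_def, mul_assoc]⟩
  have hr : ∀ (x y : A), x ∈ S → x * y ∈ S := by
    rintro _ y ⟨L, rfl⟩
    exact ⟨L.map fun p => (p.1, p.2 * y), by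
      rw [← List.sum_map_mul_right, List.map_map]; simp [Function.comp_def, mul_assoc]⟩
  let I : TwoSidedIdeal A := TwoSidedIdeal.mk' (closure S)
    (subset_closure ⟨[], by simp⟩)
    (fun {x y} hx hy => map_mem_closure₂ continuous_add hx hy hadd)
    (fun {x} hx => by
      have := map_mem_closure (continuous_const_mul (-1 : A)) hx (fun y hy => hl (-1) y hy)
      simpa using this)
    (fun {x y} hy => map_mem_closure (continuous_const_mul x) hy (fun z hz => hl x z hz))
    (fun {x y} hx => by
      have := map_mem_closure (f := fun z => z * y) (continuous_mul_const y) hx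
        (fun z hz => hr z y hz)
      exact this)
  have hI : (I : Set A) = closure S := TwoSidedIdeal.coe_mk' _ _ _ _ _ _
  have hbI : b ∈ I := by
    change b ∈ (I : Set A)
    rw [hI]
    exact subset_closure ⟨[(1, 1)], by simp⟩
  rcases hA I (by rw [hI]; exact isClosed_closure) with h | h
  · rw [h] at hbI
    exact absurd hbI hb
  · have h1 : (1 : A) ∈ closure S := by
      rw [← hI, h]; trivial
    obtain ⟨y, hy, hyd⟩ := Metric.mem_closure_iff.1 h1 1 one_pos
    have hu : IsUnit y := by
      rw [dist_eq_norm] at hyd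
      simpa using (Units.oneSub (1 - y) hyd).isUnit
    obtain ⟨z, hz⟩ := hu.exists_left_inv
    obtain ⟨L, hL⟩ := hl z y hy
    exact ⟨L, by rw [hL, hz]⟩

/-- A nonzero projection that almost commutes with suitable elements cannot almost annihilate a
given nonzero element of a simple C*-algebra. -/
theorem IsSimple.exists_le_norm_mul (hA : IsSimple A) {b : A} (hb : b ≠ 0) :
    ∃ (F : Finset A) (κ : ℝ), 0 < κ ∧ ∀ e : A, IsStarProjection e → e ≠ 0 →
      (∀ x ∈ F, ‖e * x - x * e‖ < κ) → κ ≤ ‖e * b‖ := by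
  classical
  have key : ∀ L : List (A × A), ∃ (F : Finset A) (M : ℝ), 0 ≤ M ∧
      ∀ (e : A) (δ : ℝ), (∀ x ∈ F, ‖e * x - x * e‖ ≤ δ) →
        ‖e * (L.map fun p => p.1 * b * p.2).sum‖ ≤ M * δ + M * ‖e * b‖ := by
    intro L
    induction L with
    | nil => exact ⟨∅, 0, le_rfl, fun e δ _ => by simp⟩
    | cons p L ih =>
      obtain ⟨F, M, hM, h⟩ := ih
      obtain ⟨x, y⟩ := p
      refine ⟨insert x F, M + (‖b‖ * ‖y‖ + ‖x‖ * ‖y‖), by positivity, fun e δ he => ?_⟩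
      have hx := he x (Finset.mem_insert_self x F)
      have hδ : 0 ≤ δ := (norm_nonneg _).trans hx
      have h1 := h e δ fun z hz => he z (Finset.mem_insert_of_mem hz)
      have h2 : e * (x * b * y) = (e * x - x * e) * (b * y) + x * (e * b) * y := by noncomm_ring
      have h3 : ‖(e * x - x * e) * (b * y)‖ ≤ δ * (‖b‖ * ‖y‖) :=
        (norm_mul_le _ _).trans (mul_le_mul hx (norm_mul_le _ _) (norm_nonneg _) hδ)
      have h4 : ‖x * (e * b) * y‖ ≤ ‖x‖ * ‖e * b‖ * ‖y‖ := norm_mul₃_le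
      have h5 : ‖e * (x * b * y)‖ ≤ δ * (‖b‖ * ‖y‖) + ‖x‖ * ‖e * b‖ * ‖y‖ := by
        rw [h2]; exact (norm_add_le _ _).trans (add_le_add h3 h4)
      simp only [List.map_cons, List.sum_cons, mul_add]
      have h6 := norm_add_le (e * (x * b * y)) (e * (L.map fun p => p.1 * b * p.2).sum)
      have h7 : 0 ≤ ‖x‖ * ‖y‖ * δ := by positivity
      have h8 : 0 ≤ ‖b‖ * ‖y‖ * ‖e * b‖ := by positivity
      linarith
  obtain ⟨L, hL⟩ := hA.exists_list_sum_eq_one hb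
  obtain ⟨F, M, hM, h⟩ := key L
  refine ⟨F, 1 / (2 * M + 2), by positivity, fun e he he0 hc => ?_⟩
  have h1 := h e (1 / (2 * M + 2)) fun x hx => (hc x hx).le
  rw [hL, mul_one, IsStarProjection.norm_eq_one he he0] at h1
  have h2 : M * (1 / (2 * M + 2)) ≤ 1 / 2 := by
    rw [mul_one_div, div_le_iff₀ (by positivity)]; linarith
  rw [div_le_iff₀ (by positivity)]
  nlinarith [norm_nonneg (e * b)]

/-- Any two nonzero positive elements of a simple C*-algebra have a common nonzero minorant for
Cuntz subequivalence. -/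
theorem IsSimple.exists_common_cuntzLE (hA : IsSimple A) {a b : A} (ha : IsPositive a)
    (ha0 : a ≠ 0) (hb : IsPositive b) (hb0 : b ≠ 0) :
    ∃ c : A, IsPositive c ∧ c ≠ 0 ∧ CuntzLE c a ∧ CuntzLE c b := by
  obtain ⟨s, rfl⟩ := ha
  obtain ⟨t, rfl⟩ := hb
  have hs : s ≠ 0 := by rintro rfl; simp at ha0
  have ht : t ≠ 0 := by rintro rfl; simp at hb0
  obtain ⟨x, hx⟩ : ∃ x, s * x * star t ≠ 0 := by
    -- a simple algebra is prime
    by_contra! h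
    obtain ⟨L, hL⟩ := hA.exists_list_sum_eq_one hs
    have h1 : (L.map fun p => p.1 * s * p.2).sum * star t = 0 := by
      rw [← List.sum_map_mul_right]
      refine List.sum_eq_zero fun z hz => ?_
      obtain ⟨p, -, rfl⟩ := List.mem_map.1 hz
      rw [mul_assoc p.1, mul_assoc p.1, h, mul_zero]
    rw [hL, one_mul, star_eq_zero] at h1
    exact ht h1
  -- `(y⋆ y)²` lies below both `y y⋆` and `y⋆ y`
  set y := s * x * star t with hy
  obtain ⟨r, hr, hyr⟩ :=
    IsPositive.exists_sqrt (a := star y * y) ⟨y, rfl⟩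
  have h1 : star y * y ≠ 0 := by rwa [Ne, CStarRing.star_mul_self_eq_zero_iff]
  refine ⟨star y * (y * star y) * y, ⟨star y * y, by simp [mul_assoc]⟩, ?_, ?_, ?_⟩
  · have h2 : star y * (y * star y) * y = star (star y * y) * (star y * y) := by
      simp [mul_assoc]
    rwa [h2, Ne, CStarRing.star_mul_self_eq_zero_iff]
  · refine .of_eq (r * (t * star x)) ?_
    calc star y * (y * star y) * y = (star y * y) * (star y * y) := by simp only [mul_assoc]
      _ = r * (star y * y) * r := by rw [hyr]; simp only [mul_assoc]
      _ = _ := by simp [hy, hr.star_eq, mul_assoc]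
  · refine .of_eq (star y * (s * x)) ?_
    simp [hy, mul_assoc]

end Simple

/-! ### Bounded sequences modulo null sequences -/

section Sequences

variable (B : Type*) [NormedRing B]

/-- The ring of bounded sequences in a normed ring. -/
def boundedSeq : Subring (ℕ → B) where
  carrier := {x | ∃ C : ℝ, ∀ n, ‖x n‖ ≤ C}
  mul_mem' := by
    rintro x y ⟨C, hC⟩ ⟨D, hD⟩
    exact ⟨C * D, fun n => (norm_mul_le _ _).trans
      (mul_le_mul (hC n) (hD n) (norm_nonneg _) ((norm_nonneg _).trans (hC n)))⟩
  one_mem' := ⟨‖(1 : B)‖, fun _ => le_rfl⟩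
  add_mem' := by
    rintro x y ⟨C, hC⟩ ⟨D, hD⟩
    exact ⟨C + D, fun n => (norm_add_le _ _).trans (add_le_add (hC n) (hD n))⟩
  zero_mem' := ⟨0, fun _ => by simp⟩
  neg_mem' := by
    rintro x ⟨C, hC⟩
    exact ⟨C, fun n => by simpa using hC n⟩

/-- The ideal of null sequences. -/
def nullSeq : Ideal (boundedSeq B) where
  carrier := {x | Tendsto (fun n => ‖x.1 n‖) atTop (𝓝 0)}
  add_mem' := by
    intro x y hx hy
    have := hx.add hy
    rw [add_zero] at this
    exact squeeze_zero (fun _ => norm_nonneg _) (fun n => norm_add_le _ _) this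
  zero_mem' := by
    change Tendsto (fun _ => ‖(0 : B)‖) atTop (𝓝 0)
    simp
  smul_mem' := by
    rintro ⟨c, C, hC⟩ x hx
    have := hx.const_mul C
    rw [mul_zero] at this
    exact squeeze_zero (fun _ => norm_nonneg _) (fun n => (norm_mul_le _ _).trans
      (mul_le_mul_of_nonneg_right (hC n) (norm_nonneg _))) this

instance : (nullSeq B).IsTwoSided where
  mul_mem_of_left := by
    rintro x ⟨c, C, hC⟩ hx
    have := Tendsto.mul_const C hx
    rw [zero_mul] at this
    exact squeeze_zero (fun _ => norm_nonneg _) (fun n => (norm_mul_le _ _).trans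
      (mul_le_mul_of_nonneg_left (hC n) (norm_nonneg _))) this

/-- The algebra of bounded sequences modulo null sequences. Approximate relations become exact
in it. -/
def SeqAlg : Type _ := boundedSeq B ⧸ nullSeq B

noncomputable instance : Ring (SeqAlg B) := inferInstanceAs (Ring (boundedSeq B ⧸ nullSeq B))

variable {B}

/-- The class of a bounded sequence. -/
noncomputable def seqClass : boundedSeq B →+* SeqAlg B := Ideal.Quotient.mk (nullSeq B)

theorem seqClass_eq_iff {x y : boundedSeq B} :
    seqClass x = seqClass y ↔ Tendsto (fun n => ‖x.1 n - y.1 n‖) atTop (𝓝 0) :=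
  Ideal.Quotient.mk_eq_mk_iff_sub_mem x y

/-- The constant sequence. -/
def constSeq : B →+* boundedSeq B where
  toFun b := ⟨fun _ => b, ‖b‖, fun _ => le_rfl⟩
  map_one' := rfl
  map_zero' := rfl
  map_add' _ _ := rfl
  map_mul' _ _ := rfl

end Sequences

section SequencesCStar

variable {A B : Type*} [CStarAlgebra A] [CStarAlgebra B]

/-- A ⋆-homomorphism applied to a sequence term by term. -/
def mapSeq (φ : A →⋆ₐ[ℂ] B) : boundedSeq A →+* boundedSeq B where
  toFun x := ⟨fun n => φ (x.1 n), by
    obtain ⟨x, C, hC⟩ := x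
    exact ⟨C, fun n => (NonUnitalStarAlgHom.norm_apply_le φ _).trans (hC n)⟩⟩
  map_one' := Subtype.ext (funext fun _ => map_one _)
  map_zero' := Subtype.ext (funext fun _ => map_zero _)
  map_add' _ _ := Subtype.ext (funext fun _ => map_add _ _ _)
  map_mul' _ _ := Subtype.ext (funext fun _ => map_mul _ _ _)

/-- The class of the image of a sequence under a ⋆-homomorphism. -/
noncomputable def mapClass (φ : A →⋆ₐ[ℂ] B) : boundedSeq A →+* SeqAlg B :=
  seqClass.comp (mapSeq φ)

theorem mapClass_eq (φ : A →⋆ₐ[ℂ] B) {x y : boundedSeq A}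
    (h : Tendsto (fun n => ‖x.1 n - y.1 n‖) atTop (𝓝 0)) : mapClass φ x = mapClass φ y := by
  refine seqClass_eq_iff.2 (squeeze_zero (fun n => norm_nonneg _) (fun n => ?_) h)
  change ‖φ (x.1 n) - φ (y.1 n)‖ ≤ _
  rw [← map_sub]
  exact NonUnitalStarAlgHom.norm_apply_le φ _

/-- A sequence of projections is bounded. -/
def projSeq (p : ℕ → A) (hp : ∀ n, IsStarProjection (p n)) : boundedSeq A :=
  ⟨p, 1, fun n => IsStarProjection.norm_le_one (hp n)⟩

theorem tendsto_zero_of_lt_one_div {f : ℕ → ℝ} (h0 : ∀ n, 0 ≤ f n)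
    (h : ∀ n, f n < 1 / ((n : ℝ) + 1)) : Tendsto f atTop (𝓝 0) :=
  squeeze_zero h0 (fun n => (h n).le) tendsto_one_div_add_atTop_nhds_zero_nat

end SequencesCStar

/-! ### The coefficient algebra and the canonical unitaries of a crossed product -/

section CrossedProductBasic

variable {G : Type v} [Group G] [Fintype G] {A : Type u} [CStarAlgebra A]

namespace CrossedProduct

open Classical in
/-- The underlying function of the inclusion of the coefficient algebra. -/
noncomputable def inclFun (α : G →* (A ≃⋆ₐ[ℂ] A)) (a : A) : CrossedProduct α :=
  fun g => if g = 1 then a else 0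

open Classical in
theorem inclFun_apply (α : G →* (A ≃⋆ₐ[ℂ] A)) (a : A) (g : G) :
    inclFun α a g = if g = 1 then a else 0 := rfl

/-- The inclusion `a ↦ a u_1` of the coefficient algebra. -/
noncomputable def incl (α : G →* (A ≃⋆ₐ[ℂ] A)) : A →⋆ₐ[ℂ] CrossedProduct α where
  toFun := inclFun α
  map_one' := rfl
  map_zero' := by ext g; simp [inclFun_apply]
  map_add' a b := by
    ext g
    by_cases h : g = 1 <;> simp [h, inclFun_apply]
  map_mul' a b := by
    ext g
    rw [mul_apply, Finset.sum_eq_single 1]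
    · by_cases h : g = 1 <;> simp [h, inclFun_apply]
    · intro h _ hh
      rw [inclFun_apply, if_neg hh, zero_mul]
    · simp
  commutes' r := by
    ext g
    rw [Algebra.algebraMap_eq_smul_one, Algebra.algebraMap_eq_smul_one, smul_apply, one_apply]
    by_cases h : g = 1 <;> simp [h, inclFun_apply]
  map_star' a := by
    ext g
    rw [star_apply]
    by_cases h : g = 1
    · simp [h, inclFun_apply]
    · simp [h, inclFun_apply]

open Classical in
theorem incl_apply (α : G →* (A ≃⋆ₐ[ℂ] A)) (a : A) (g : G) :
    incl α a g = if g = 1 then a else 0 := rfl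

open Classical in
/-- The canonical unitary `u_g`. -/
noncomputable def unitary (α : G →* (A ≃⋆ₐ[ℂ] A)) (g : G) : CrossedProduct α :=
  fun k => if k = g then 1 else 0

open Classical in
theorem unitary_apply (α : G →* (A ≃⋆ₐ[ℂ] A)) (g k : G) :
    unitary α g k = if k = g then 1 else 0 := rfl

variable {α : G →* (A ≃⋆ₐ[ℂ] A)}

theorem incl_mul_apply (a : A) (x : CrossedProduct α) (g : G) : (incl α a * x) g = a * x g := by
  rw [mul_apply, Finset.sum_eq_single 1]
  · simp [incl_apply]
  · intro h _ hh
    rw [incl_apply, if_neg hh, zero_mul]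
  · simp

theorem mul_unitary_apply (x : CrossedProduct α) (h g : G) :
    (x * unitary α h) g = x (g * h⁻¹) := by
  rw [mul_apply, Finset.sum_eq_single (g * h⁻¹)]
  · simp [unitary_apply]
  · intro k _ hk
    rw [unitary_apply, if_neg, map_zero, mul_zero]
    rintro rfl
    exact hk (by group)
  · simp

theorem unitary_mul_unitary (g h : G) : unitary α g * unitary α h = unitary α (g * h) := by
  ext k
  rw [mul_unitary_apply, unitary_apply, unitary_apply]
  by_cases h' : k = g * h
  · rw [if_pos h', if_pos (by rw [h', mul_inv_cancel_right])]
  · rw [if_neg h', if_neg (by rintro rfl; simp at h')]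

theorem unitary_one : unitary α 1 = 1 := rfl

theorem star_unitary (g : G) : star (unitary α g) = unitary α g⁻¹ := by
  ext k
  rw [star_apply, unitary_apply, unitary_apply]
  by_cases h : k = g⁻¹
  · simp [h]
  · rw [if_neg h, if_neg (by rintro rfl; simp at h)]; simp

theorem unitary_mul_incl (g : G) (a : A) :
    unitary α g * incl α a = incl α (α g a) * unitary α g := by
  ext k
  rw [incl_mul_apply, mul_apply, Finset.sum_eq_single g]
  · rw [unitary_apply, if_pos rfl, one_mul, incl_apply, unitary_apply]
    by_cases h : k = g
    · simp [h]
    · simp [h, inv_mul_eq_one, Ne.symm h]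
  · intro h _ hh
    rw [unitary_apply, if_neg hh, zero_mul]
  · simp

theorem sum_apply {ι : Type*} (s : Finset ι) (f : ι → CrossedProduct α) (g : G) :
    (∑ i ∈ s, f i) g = ∑ i ∈ s, f i g := by
  classical
  induction s using Finset.induction_on with
  | empty => simp
  | insert i s hi ih => rw [Finset.sum_insert hi, Finset.sum_insert hi, add_apply, ih]

/-- Every element is the sum of its terms `x_g u_g`. -/
theorem eq_sum_incl_mul_unitary (x : CrossedProduct α) :
    x = ∑ g, incl α (x g) * unitary α g := by
  ext k
  rw [sum_apply, Finset.sum_eq_single k]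
  · rw [incl_mul_apply, unitary_apply, if_pos rfl, mul_one]
  · intro g _ hg
    rw [incl_mul_apply, unitary_apply, if_neg hg.symm, mul_zero]
  · simp

theorem norm_incl_le (a : A) : ‖incl α a‖ ≤ ‖a‖ := NonUnitalStarAlgHom.norm_apply_le (incl α) a

theorem incl_injective : Function.Injective (incl α) := fun a b h => by
  have := congrFun h 1
  simpa [incl_apply] using this

/-- The conditional expectation `x ↦ x_1` is positive. -/
theorem isPositive_apply_one {a : CrossedProduct α} (ha : IsPositive a) : IsPositive (a 1) := by
  let _ := CStarAlgebra.spectralOrder A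
  have := CStarAlgebra.spectralOrderedRing A
  obtain ⟨b, rfl⟩ := ha
  rw [isPositive_iff_nonneg, mul_apply]
  refine Finset.sum_nonneg fun h _ => ?_
  rw [star_apply, mul_one, ← map_mul, ← isPositive_iff_nonneg]
  exact ⟨α h (b h⁻¹), by rw [map_mul, map_star]⟩

/-- The conditional expectation `x ↦ x_1` is faithful. -/
theorem apply_one_ne_zero {a : CrossedProduct α} (ha : IsPositive a) (h0 : a ≠ 0) : a 1 ≠ 0 := by
  let _ := CStarAlgebra.spectralOrder A
  have := CStarAlgebra.spectralOrderedRing A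
  obtain ⟨b, rfl⟩ := ha
  intro h
  rw [mul_apply, Finset.sum_eq_zero_iff_of_nonneg] at h
  · have hb : b = 0 := by
      ext g
      have h1 := h g⁻¹ (Finset.mem_univ _)
      rw [star_apply, mul_one, ← map_mul] at h1
      have h2 := (map_eq_zero_iff (α g⁻¹) (α g⁻¹).injective).1 h1
      rw [CStarRing.star_mul_self_eq_zero_iff, inv_inv] at h2
      exact h2
    simp [hb] at h0
  · intro h _
    rw [star_apply, mul_one, ← map_mul, ← isPositive_iff_nonneg]
    exact ⟨α h (b h⁻¹), by rw [map_mul, map_star]⟩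

end CrossedProduct

end CrossedProductBasic

/-! ### Rokhlin projections -/

section Rokhlin

variable {G : Type v} [Group G] [Fintype G] {A : Type u} [CStarAlgebra A]

/-- A family of nonzero mutually orthogonal projections that almost commute with `F` and are
almost permuted by the action. -/
structure IsRokhlinFamily (α : G →* (A ≃⋆ₐ[ℂ] A)) (F : Finset A) (ε : ℝ) (p : G → A) : Prop where
  proj : ∀ g, IsStarProjection (p g)
  orth : ∀ g h, g ≠ h → p g * p h = 0
  comm : ∀ a ∈ F, ∀ g, ‖p g * a - a * p g‖ < ε
  shift : ∀ g h, ‖α g (p h) - p (g * h)‖ < ε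
  ne_zero : ∀ g, p g ≠ 0

theorem isStarProjection_sum {B ι : Type*} [CStarAlgebra B] (s : Finset ι) {e : ι → B}
    (he : ∀ i, IsStarProjection (e i)) (ho : ∀ i j, i ≠ j → e i * e j = 0) :
    IsStarProjection (∑ i ∈ s, e i) := by
  classical
  induction s using Finset.induction_on with
  | empty => simp
  | insert i s hi ih =>
    rw [Finset.sum_insert hi]
    refine (he i).add ih ?_
    rw [Finset.mul_sum]
    exact Finset.sum_eq_zero fun j hj => ho i j (by rintro rfl; exact hi hj)

/-- The tracial Rokhlin property yields Rokhlin families whose defect `1 - ∑ p_g` is Cuntz below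
a prescribed nonzero element. -/
theorem HasTracialRokhlinProperty.exists_isRokhlinFamily {α : G →* (A ≃⋆ₐ[ℂ] A)}
    (hα : HasTracialRokhlinProperty α) (F : Finset A) {ε : ℝ} (hε : 0 < ε) {c : A}
    (hc : IsPositive c) (hc0 : c ≠ 0) :
    ∃ p : G → A, IsRokhlinFamily α F ε p ∧ CuntzLE (1 - ∑ g, p g) c := by
  have hn : 0 < ‖c‖ := norm_pos_iff.2 hc0
  have hsqrt : (((√‖c‖)⁻¹ : ℝ) : ℂ) * (((√‖c‖)⁻¹ : ℝ) : ℂ) = ((‖c‖⁻¹ : ℝ) : ℂ) := by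
    rw [← Complex.ofReal_mul, ← mul_inv, Real.mul_self_sqrt hn.le]
  have hx : IsPositive (((‖c‖⁻¹ : ℝ) : ℂ) • c) := by
    have h1 := hc.conj ((((√‖c‖)⁻¹ : ℝ) : ℂ) • (1 : A))
    rwa [star_smul, star_one, smul_mul_assoc, one_mul, mul_smul_comm, mul_one, RCLike.star_def,
      Complex.conj_ofReal, smul_smul, hsqrt] at h1
  have hx1 : ‖((‖c‖⁻¹ : ℝ) : ℂ) • c‖ = 1 := by
    rw [norm_smul, Complex.norm_real, norm_inv, norm_norm, inv_mul_cancel₀ hn.ne']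
  have h1p : IsPositive (1 : A) := ⟨1, by simp⟩
  obtain ⟨p, hp, ho, hcomm, hshift, hcut, hnorm⟩ :=
    hα F (min ε (1 / 2)) _ 1 (by positivity) hx h1p hx1
  have hε1 : min ε (1 / 2) ≤ 1 / 2 := min_le_right _ _
  refine ⟨p, ⟨hp, ho, fun a ha g => (hcomm a ha g).trans_le (min_le_left _ _),
    fun g k => (hshift g k).trans_le (min_le_left _ _), fun g hg => ?_⟩, ?_⟩
  · -- if one Rokhlin projection vanishes, then all do, against the norm condition
    have hz : ∀ k, p k = 0 := by
      intro k
      by_contra hk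
      have h1 := hshift (k * g⁻¹) g
      rw [hg, map_zero, zero_sub, norm_neg, inv_mul_cancel_right,
        IsStarProjection.norm_eq_one (hp k) hk] at h1
      linarith
    simp only [hz, Finset.sum_const_zero, zero_mul, norm_zero] at hnorm
    linarith
  · -- with `y = 1` the cut-down in the Rokhlin property is a multiple of the projection `1 - ∑ p_g`
    have h2 : IsStarProjection (1 - ∑ g, p g) :=
      (isStarProjection_sum Finset.univ hp ho).one_sub
    rw [one_pow, one_mul, mul_one,
      IsStarProjection.cutDown_eq h2 (by positivity) (by linarith)] at hcut
    refine (CuntzLE.of_smul (by linarith) hcut).trans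
      (.of_eq ((((√‖c‖)⁻¹ : ℝ) : ℂ) • (1 : A)) ?_)
    rw [star_smul, star_one, smul_mul_assoc, one_mul, mul_smul_comm, mul_one, RCLike.star_def,
      Complex.conj_ofReal, smul_smul, hsqrt]

section RokhlinSeq

variable {B : Type*} [CStarAlgebra B] {α : G →* (A ≃⋆ₐ[ℂ] A)} {φ : A →⋆ₐ[ℂ] B} {u : G → B}
  {F : Finset A} {p : ℕ → G → A}

/-- The covariance relation passes to sequences. -/
theorem constSeq_mul_mapClass (hu : ∀ g a, u g * φ a = φ (α g a) * u g) (g : G) (x : boundedSeq A) :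
    seqClass (constSeq (u g)) * mapClass φ x =
      mapClass φ (mapSeq (StarAlgHomClass.toStarAlgHom (α g)) x) * seqClass (constSeq (u g)) := by
  change seqClass _ * seqClass _ = seqClass _ * seqClass _
  rw [← map_mul, ← map_mul]
  exact congrArg _ (Subtype.ext (funext fun n => hu g (x.1 n)))

/-- The sequence of the projections indexed by `g` in a sequence of Rokhlin families. -/
def rokhlinSeq (hp : ∀ n : ℕ, IsRokhlinFamily α F (1 / ((n : ℝ) + 1)) (p n)) (g : G) :
    boundedSeq A :=
  projSeq (fun n => p n g) fun n => (hp n).proj g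

theorem rokhlinSeq_mul_self (hp : ∀ n : ℕ, IsRokhlinFamily α F (1 / ((n : ℝ) + 1)) (p n)) (g : G) :
    rokhlinSeq hp g * rokhlinSeq hp g = rokhlinSeq hp g :=
  Subtype.ext (funext fun n => ((hp n).proj g).isIdempotentElem)

theorem rokhlinSeq_mul_of_ne (hp : ∀ n : ℕ, IsRokhlinFamily α F (1 / ((n : ℝ) + 1)) (p n))
    {g h : G} (hgh : g ≠ h) : rokhlinSeq hp g * rokhlinSeq hp h = 0 :=
  Subtype.ext (funext fun n => (hp n).orth g h hgh)

theorem mapClass_rokhlinSeq_comm (hp : ∀ n : ℕ, IsRokhlinFamily α F (1 / ((n : ℝ) + 1)) (p n))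
    (g : G) {x : A} (hx : x ∈ F) :
    mapClass φ (rokhlinSeq hp g) * mapClass φ (constSeq x) =
      mapClass φ (constSeq x) * mapClass φ (rokhlinSeq hp g) := by
  rw [← map_mul, ← map_mul]
  exact mapClass_eq φ (tendsto_zero_of_lt_one_div (fun n => norm_nonneg _)
    fun n => (hp n).comm x hx g)

/-- Modulo null sequences, Rokhlin projections are permuted exactly. -/
theorem constSeq_mul_rokhlinSeq (hu : ∀ g a, u g * φ a = φ (α g a) * u g)
    (hp : ∀ n : ℕ, IsRokhlinFamily α F (1 / ((n : ℝ) + 1)) (p n)) (g h : G) :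
    seqClass (constSeq (u g)) * mapClass φ (rokhlinSeq hp h) =
      mapClass φ (rokhlinSeq hp (g * h)) * seqClass (constSeq (u g)) := by
  rw [constSeq_mul_mapClass hu]
  congr 1
  exact mapClass_eq φ (tendsto_zero_of_lt_one_div (fun n => norm_nonneg _)
    fun n => (hp n).shift g h)

end RokhlinSeq

end Rokhlin

/-! ### Small positive elements of the coefficient algebra -/

section Dominance

variable {G : Type v} [Group G] [Fintype G] {A : Type u} [CStarAlgebra A]
  {α : G →* (A ≃⋆ₐ[ℂ] A)}

open CrossedProduct

/-- Compression by a Rokhlin projection turns an element of the crossed product, asymptotically,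
into its coefficient at `1`. -/
theorem tendsto_compression {F : Finset A} {p : ℕ → G → A}
    (hp : ∀ n : ℕ, IsRokhlinFamily α F (1 / ((n : ℝ) + 1)) (p n)) (a : CrossedProduct α)
    (ha : ∀ g, a g ∈ F) :
    Tendsto (fun n => ‖incl α (p n 1) * a * incl α (p n 1) - incl α (p n 1 * a 1 * p n 1)‖)
      atTop (𝓝 0) := by
  set P : G → SeqAlg (CrossedProduct α) := fun g => mapClass (incl α) (rokhlinSeq hp g) with hP
  set U : G → SeqAlg (CrossedProduct α) := fun g => seqClass (constSeq (unitary α g)) with hU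
  set X : G → SeqAlg (CrossedProduct α) := fun g => mapClass (incl α) (constSeq (a g)) with hX
  have hPP : P 1 * P 1 = P 1 := by
    simp only [hP]; rw [← map_mul, rokhlinSeq_mul_self]
  have hPX : ∀ g, P 1 * X g = X g * P 1 := fun g => mapClass_rokhlinSeq_comm hp 1 (ha g)
  have ha' : seqClass (constSeq a) = ∑ g, X g * U g := by
    conv_lhs => rw [eq_sum_incl_mul_unitary a]
    rw [map_sum, map_sum]
    exact Finset.sum_congr rfl fun g _ => by rw [map_mul, map_mul]; rfl
  have key : P 1 * seqClass (constSeq a) * P 1 = P 1 * X 1 * P 1 := by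
    rw [ha', Finset.mul_sum, Finset.sum_mul, Finset.sum_eq_single 1]
    · have : U 1 = 1 := by simp only [hU]; rw [unitary_one, map_one, map_one]
      rw [this, mul_one]
    · intro g _ hg
      have h1 : U g * P 1 = P g * U g := by
        have := constSeq_mul_rokhlinSeq (φ := incl α) unitary_mul_incl hp g 1
        rwa [mul_one] at this
      have h2 : P 1 * P g = 0 := by
        simp only [hP]; rw [← map_mul, rokhlinSeq_mul_of_ne hp (Ne.symm hg), map_zero]
      calc P 1 * (X g * U g) * P 1 = P 1 * X g * (U g * P 1) := by simp only [mul_assoc]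
        _ = X g * (P 1 * P g) * U g := by rw [h1, hPX]; simp only [mul_assoc]
        _ = 0 := by rw [h2, mul_zero, zero_mul]
    · simp
  let x : boundedSeq (CrossedProduct α) :=
    mapSeq (incl α) (rokhlinSeq hp 1) * constSeq a * mapSeq (incl α) (rokhlinSeq hp 1)
  let y : boundedSeq (CrossedProduct α) :=
    mapSeq (incl α) (rokhlinSeq hp 1 * constSeq (a 1) * rokhlinSeq hp 1)
  have hxy : seqClass x = seqClass y := by
    simp only [x, y, map_mul]
    exact key
  exact seqClass_eq_iff.1 hxy

/-- Below every nonzero positive element of the crossed product there is a nonzero positive element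
of the coefficient algebra, as far as projections are concerned. -/
theorem exists_cuntzLE_incl (hA : IsSimple A) (hα : HasTracialRokhlinProperty α)
    {a : CrossedProduct α} (ha : IsPositive a) (ha0 : a ≠ 0) :
    ∃ c : A, IsPositive c ∧ c ≠ 0 ∧ ∀ x : CrossedProduct α, IsStarProjection x →
      CuntzLE x (incl α c) → CuntzLE x a := by
  classical
  have h1p := isPositive_apply_one ha
  have h10 := apply_one_ne_zero ha ha0
  obtain ⟨F, κ, hκ, hF⟩ := hA.exists_le_norm_mul h10
  choose p hp _ using fun n : ℕ => hα.exists_isRokhlinFamily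
    (F ∪ Finset.univ.image a) (ε := 1 / ((n : ℝ) + 1)) (by positivity) h1p h10
  have hlim := tendsto_compression hp a fun g =>
    Finset.mem_union_right _ (Finset.mem_image_of_mem _ (Finset.mem_univ g))
  have hsmall : ∀ᶠ n : ℕ in atTop, 1 / ((n : ℝ) + 1) < κ / 2 :=
    tendsto_one_div_add_atTop_nhds_zero_nat.eventually (gt_mem_nhds (by positivity))
  obtain ⟨n, hn1, hn2⟩ := (hsmall.and
    (hlim.eventually (gt_mem_nhds (show (0 : ℝ) < κ / 2 / 8 by positivity)))).exists
  set q := p n 1 with hq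
  have hqp : IsStarProjection q := (hp n).proj 1
  have hcomm := fun x hx => (hp n).comm x hx 1
  have hlow : κ ≤ ‖q * a 1‖ := hF q hqp ((hp n).ne_zero 1) fun x hx =>
    (hcomm x (Finset.mem_union_left _ hx)).trans (by linarith)
  set z := q * a 1 * q with hz
  have hzp : IsPositive z := by
    have := h1p.conj q
    rwa [hqp.isSelfAdjoint.star_eq] at this
  have hznorm : κ / 2 < ‖z‖ := by
    have h2 : q * a 1 - z = q * (q * a 1 - a 1 * q) := by
      rw [hz, mul_sub, ← mul_assoc, ← mul_assoc, hqp.isIdempotentElem.eq]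
    have h3 : ‖q * a 1 - z‖ < κ / 2 := by
      rw [h2]
      calc _ ≤ 1 * ‖q * a 1 - a 1 * q‖ := (norm_mul_le _ _).trans
            (mul_le_mul_of_nonneg_right (IsStarProjection.norm_le_one hqp) (norm_nonneg _))
        _ < κ / 2 := by
          rw [one_mul]
          exact (hcomm (a 1) (Finset.mem_union_right _
            (Finset.mem_image_of_mem _ (Finset.mem_univ 1)))).trans hn1
    linarith [norm_sub_norm_le (q * a 1) z]
  obtain ⟨c, hc, -, hcne, hcle⟩ :=
    exists_cutoff_cuntzLE (incl α) hzp (show (0 : ℝ) < κ / 2 by positivity)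
  refine ⟨c, hc, ?_, fun x hx hxc => hcle a (incl α q) x ha.isSelfAdjoint
    (hqp.map (incl α)).isSelfAdjoint hn2.le hx hxc⟩
  have := hcne 1 (.one A) (by rwa [mul_one])
  rwa [mul_one] at this

/-- A nonzero positive element of the coefficient algebra splits into two pieces, cut out by two
Rokhlin projections. -/
theorem exists_pair_cuntzLE [Nontrivial G] (hA : IsSimple A) (hα : HasTracialRokhlinProperty α)
    {B : Type*} [CStarAlgebra B] (φ : A →⋆ₐ[ℂ] B) {a : A} (ha : IsPositive a) (ha0 : a ≠ 0) :
    ∃ c d : A, IsPositive c ∧ c ≠ 0 ∧ IsPositive d ∧ d ≠ 0 ∧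
      ∀ x y : B, IsStarProjection x → IsStarProjection y → x * y = 0 →
        CuntzLE x (φ c) → CuntzLE y (φ d) → CuntzLE (x + y) (φ a) := by
  classical
  obtain ⟨F, κ, hκ, hF⟩ := hA.exists_le_norm_mul ha0
  obtain ⟨p, hp, -⟩ := hα.exists_isRokhlinFamily (insert a F) (ε := κ / 32) (by positivity) ha ha0
  obtain ⟨k, hk⟩ := exists_ne (1 : G)
  have hlow : ∀ g, κ / 2 < ‖p g * a * p g‖ := by
    intro g
    have h1 : κ ≤ ‖p g * a‖ := hF (p g) (hp.proj g) (hp.ne_zero g) fun x hx =>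
      (hp.comm x (Finset.mem_insert_of_mem hx) g).trans (by linarith)
    have h2 : p g * a - p g * a * p g = p g * (p g * a - a * p g) := by
      rw [mul_sub, ← mul_assoc, ← mul_assoc, (hp.proj g).isIdempotentElem.eq]
    have h3 : ‖p g * a - p g * a * p g‖ < κ / 2 := by
      rw [h2]
      calc _ ≤ 1 * ‖p g * a - a * p g‖ := (norm_mul_le _ _).trans
            (mul_le_mul_of_nonneg_right (IsStarProjection.norm_le_one (hp.proj g)) (norm_nonneg _))
        _ < κ / 2 := by
          rw [one_mul]
          exact (hp.comm a (Finset.mem_insert_self _ _) g).trans (by linarith)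
    linarith [norm_sub_norm_le (p g * a) (p g * a * p g)]
  -- the off-diagonal compressions are small, because `a` almost commutes with orthogonal projections
  have hoff : ∀ g h, g ≠ h → ‖p g * a * p h‖ ≤ κ / 32 := by
    intro g h hgh
    have h1 : p g * a * p h = (p g * a - a * p g) * p h := by
      rw [sub_mul, mul_assoc a, hp.orth g h hgh, mul_zero, sub_zero]
    rw [h1]
    calc _ ≤ ‖p g * a - a * p g‖ * 1 := (norm_mul_le _ _).trans
          (mul_le_mul_of_nonneg_left (IsStarProjection.norm_le_one (hp.proj h)) (norm_nonneg _))
      _ ≤ κ / 32 := by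
        rw [mul_one]; exact (hp.comm a (Finset.mem_insert_self _ _) g).le
  generalize hP : p 1 = P at *
  generalize hQ : p k = Q at *
  have hPp : IsStarProjection P := hP ▸ hp.proj 1
  have hQp : IsStarProjection Q := hQ ▸ hp.proj k
  have hPQ : P * Q = 0 := by rw [← hP, ← hQ]; exact hp.orth 1 k hk.symm
  have hQP : Q * P = 0 := by rw [← hP, ← hQ]; exact hp.orth k 1 hk
  have hPP := hPp.isIdempotentElem.eq
  have hQQ := hQp.isIdempotentElem.eq
  set z := P * a * P + Q * a * Q with hz
  have hzpos : IsPositive z := by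
    have h1 := ha.conj P
    have h2 := ha.conj Q
    rw [hPp.isSelfAdjoint.star_eq] at h1
    rw [hQp.isSelfAdjoint.star_eq] at h2
    exact h1.add h2
  have hzP : z * P = P * a * P := by
    rw [hz, add_mul, mul_assoc _ P P, hPP, mul_assoc _ Q P, hQP, mul_zero, add_zero]
  have hPz : P * z = P * a * P := by
    rw [hz, mul_add, ← mul_assoc, ← mul_assoc, hPP, ← mul_assoc, ← mul_assoc, hPQ, zero_mul,
      zero_mul, add_zero]
  have hzQ : z * Q = Q * a * Q := by
    rw [hz, add_mul, mul_assoc _ Q Q, hQQ, mul_assoc _ P Q, hPQ, mul_zero, zero_add]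
  have hQz : Q * z = Q * a * Q := by
    rw [hz, mul_add, ← mul_assoc, ← mul_assoc, hQP, ← mul_assoc, ← mul_assoc, hQQ, zero_mul,
      zero_mul, zero_add]
  obtain ⟨c, hc, hcomm, hcne, hcle⟩ :=
    exists_cutoff_cuntzLE φ hzpos (show (0 : ℝ) < κ / 2 by positivity)
  have hcP : Commute c P := hcomm P (by rw [Commute, SemiconjBy, hzP, hPz])
  have hcQ : Commute c Q := hcomm Q (by rw [Commute, SemiconjBy, hzQ, hQz])
  have hpos : ∀ e, IsStarProjection e → Commute c e → IsPositive (c * e) := by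
    intro e he hce
    have := hc.conj e
    rwa [he.isSelfAdjoint.star_eq, ← hce.eq, mul_assoc, he.isIdempotentElem.eq] at this
  refine ⟨c * P, c * Q, hpos P hPp hcP, ?_, hpos Q hQp hcQ, ?_, ?_⟩
  · exact hcne P hPp (by rw [hzP, ← hP]; exact hlow 1)
  · exact hcne Q hQp (by rw [hzQ, ← hQ]; exact hlow k)
  · intro x y hx hy hxy hxc hyc
    refine hcle (φ a) (φ (P + Q)) (x + y) (ha.map φ).isSelfAdjoint
      ((hPp.add hQp hPQ).map φ).isSelfAdjoint ?_ (hx.add hy hxy) ?_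
    · rw [← map_mul, ← map_mul, ← map_sub]
      refine (NonUnitalStarAlgHom.norm_apply_le φ _).trans ?_
      have h1 : (P + Q) * a * (P + Q) - z = P * a * Q + Q * a * P := by
        rw [hz]; noncomm_ring
      have h2 := hoff 1 k hk.symm
      have h3 := hoff k 1 hk
      rw [hP, hQ] at h2 h3
      rw [h1]
      linarith [norm_add_le (P * a * Q) (Q * a * P)]
    · rw [map_mul] at hxc hyc
      exact CuntzLE.add_of_orthogonal (hPp.map φ) (hQp.map φ)
        (by rw [← map_mul, hPQ, map_zero]) (hcP.map φ) (hcQ.map φ) hxc hyc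

/-- For a nontrivial group, every nonzero positive element of the coefficient algebra dominates
any given number of orthogonal copies of some nonzero positive element. -/
theorem exists_sum_cuntzLE [Nontrivial G] (hA : IsSimple A) (hα : HasTracialRokhlinProperty α)
    {B : Type*} [CStarAlgebra B] (φ : A →⋆ₐ[ℂ] B) {ι : Type*} (s : Finset ι) :
    ∀ {a : A}, IsPositive a → a ≠ 0 → ∃ c : A, IsPositive c ∧ c ≠ 0 ∧
      ∀ e : ι → B, (∀ i, IsStarProjection (e i)) → (∀ i j, i ≠ j → e i * e j = 0) →
        (∀ i ∈ s, CuntzLE (e i) (φ c)) → CuntzLE (∑ i ∈ s, e i) (φ a) := by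
  classical
  induction s using Finset.induction_on with
  | empty => exact fun {a} ha ha0 => ⟨a, ha, ha0, fun e _ _ _ => by simpa using CuntzLE.zero _⟩
  | insert i s hi ih =>
    intro a ha ha0
    obtain ⟨c, d, hc, hc0, hd, hd0, hcd⟩ := exists_pair_cuntzLE hA hα φ ha ha0
    obtain ⟨c', hc', hc0', hs⟩ := ih hc hc0
    obtain ⟨b, hb, hb0, hbc, hbd⟩ := hA.exists_common_cuntzLE hc' hc0' hd hd0
    refine ⟨b, hb, hb0, fun e he ho hle => ?_⟩
    rw [Finset.sum_insert hi, add_comm]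
    refine hcd _ _ (isStarProjection_sum s he ho) (he i) ?_ ?_
      ((hle i (Finset.mem_insert_self i s)).trans (hbd.map φ))
    · rw [Finset.sum_mul]
      exact Finset.sum_eq_zero fun j hj => ho j i (by rintro rfl; exact hi hj)
    · exact hs e he ho fun j hj => (hle j (Finset.mem_insert_of_mem hj)).trans (hbc.map φ)

/-- Given a nonzero positive element `a` of the crossed product, the remainder `1 - ∑ p_g` of a
Rokhlin family and further orthogonal projections `e_g` can be made small enough to fit under `a`
together. For the trivial group the unit serves as Rokhlin family, because the coefficient algebra
may then be finite dimensional and need not contain orthogonal positive elements. -/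
theorem exists_isRokhlinFamily_cuntzLE (hA : IsSimple A) (hα : HasTracialRokhlinProperty α)
    {a : CrossedProduct α} (ha : IsPositive a) (ha0 : a ≠ 0) :
    ∃ c : A, IsPositive c ∧ c ≠ 0 ∧ ∀ (F : Finset A) (ε : ℝ), 0 < ε →
      ∃ p : G → A, IsRokhlinFamily α F ε p ∧ ∀ e : G → CrossedProduct α,
        (∀ g, IsStarProjection (e g)) → (∀ g h, g ≠ h → e g * e h = 0) →
        (∀ g, e g * incl α (1 - ∑ g, p g) = 0) → (∀ g, CuntzLE (e g) (incl α c)) →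
        CuntzLE (incl α (1 - ∑ g, p g) + ∑ g, e g) a := by
  obtain ⟨a', ha', ha0', hle⟩ := exists_cuntzLE_incl hA hα ha ha0
  rcases subsingleton_or_nontrivial G with hG | hG
  · have huniv : (Finset.univ : Finset G) = {1} := by
      ext g; simp [Subsingleton.elim g 1]
    have h10 : (1 : A) ≠ 0 := fun h => ha0' (by rw [← mul_one a', h, mul_zero])
    refine ⟨a', ha', ha0', fun F ε hε => ⟨fun _ => 1, ⟨fun _ => .one A,
      fun g h hgh => absurd (Subsingleton.elim g h) hgh, fun a _ _ => by simpa using hε,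
      fun _ _ => by simpa using hε, fun _ => h10⟩, fun e he _ _ hec => ?_⟩⟩
    rw [huniv, Finset.sum_singleton, Finset.sum_singleton, sub_self, map_zero, zero_add]
    exact hle _ (he 1) (hec 1)
  · obtain ⟨c, hc, hc0, hsum⟩ :=
      exists_sum_cuntzLE hA hα (incl α) (Finset.univ : Finset (Option G)) ha' ha0'
    refine ⟨c, hc, hc0, fun F ε hε => ?_⟩
    obtain ⟨p, hp, hpc⟩ := hα.exists_isRokhlinFamily F hε hc hc0
    refine ⟨p, hp, fun e he ho heo hec => ?_⟩
    have hr : IsStarProjection (incl α (1 - ∑ g, p g)) :=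
      (isStarProjection_sum Finset.univ hp.proj hp.orth).one_sub.map (incl α)
    set r := incl α (1 - ∑ g, p g) with hr_def
    have hre : ∀ g, r * e g = 0 := by
      intro g
      rw [← star_inj, star_mul, hr.isSelfAdjoint.star_eq, (he g).isSelfAdjoint.star_eq, heo g,
        star_zero]
    let f : Option G → CrossedProduct α := fun o => o.elim r e
    have hf : ∀ o, IsStarProjection (f o) := by
      rintro (_ | g)
      exacts [hr, he g]
    have hfo : ∀ i j, i ≠ j → f i * f j = 0 := by
      rintro (_ | g) (_ | h) hij
      · exact absurd rfl hij
      · exact hre h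
      · exact heo g
      · exact ho g h fun hgh => hij (by rw [hgh])
    have hfc : ∀ o ∈ (Finset.univ : Finset (Option G)), CuntzLE (f o) (incl α c) := by
      rintro (_ | g) _
      exacts [hpc.map (incl α), hec g]
    have h1 := hsum f hf hfo hfc
    have h2 := isStarProjection_sum (Finset.univ : Finset (Option G)) hf hfo
    have h3 := hle _ h2 h1
    rwa [Fintype.sum_option] at h3

end Dominance

/-! ### Subalgebras generated by matrix units -/

section MatrixUnits

/-- The image of an injective ⋆-homomorphism, which need not be unital. -/
noncomputable def UnitalCStarSubalgebra.ofInjective {M : Type*} {B : Type u} [CStarAlgebra M]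
    [CStarAlgebra B]
    (ψ : M →⋆ₙₐ[ℂ] B) (hψ : Function.Injective ψ) : UnitalCStarSubalgebra B where
  toNonUnitalStarSubalgebra := NonUnitalStarAlgHom.range ψ
  isClosed' := (NonUnitalStarAlgHom.isometry ψ hψ).isClosedEmbedding.isClosed_range
  unit := ψ 1
  unit_mem' := ⟨1, rfl⟩
  unit_mul' := by
    rintro _ ⟨x, rfl⟩
    exact (map_mul ψ 1 x).symm.trans (by rw [one_mul]; rfl)
  mul_unit' := by
    rintro _ ⟨x, rfl⟩
    exact (map_mul ψ x 1).symm.trans (by rw [mul_one]; rfl)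

/-- An injective ⋆-homomorphism is an isomorphism onto its image. -/
theorem UnitalCStarSubalgebra.nonempty_starAlgEquiv_ofInjective {M : Type*} {B : Type u}
    [CStarAlgebra M] [CStarAlgebra B] (ψ : M →⋆ₙₐ[ℂ] B) (hψ : Function.Injective ψ) :
    Nonempty ((UnitalCStarSubalgebra.ofInjective ψ hψ).Carrier ≃⋆ₐ[ℂ] M) :=
  ⟨(StarAlgEquiv.ofInjective' ψ hψ).symm⟩

variable {E B : Type*} [CStarAlgebra E] [CStarAlgebra B] {n : Type*} [Fintype n] [DecidableEq n]

/-- The homomorphism `M_n(E) → B` determined by a homomorphism `j : E → B` and partial isometries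
`w_i` with `w_i⋆ w_k = δ_{ik} j(1)`. -/
noncomputable def matrixUnitsHom (j : E →⋆ₙₐ[ℂ] B) (w : n → B)
    (hw : ∀ i k, star (w i) * w k = if i = k then j 1 else 0) :
    CStarMatrix n n E →⋆ₙₐ[ℂ] B where
  toFun M := ∑ i, ∑ k, w i * j (M i k) * star (w k)
  map_smul' r M := by
    simp only [CStarMatrix.smul_apply, map_smul, mul_smul_comm, smul_mul_assoc, Finset.smul_sum,
      MonoidHom.id_apply]
  map_zero' := by simp
  map_add' M N := by
    simp only [CStarMatrix.add_apply, map_add, mul_add, add_mul, Finset.sum_add_distrib]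
  map_mul' M N := by
    have h1 : ∀ x : E, j 1 * j x = j x := fun x => by rw [← map_mul, one_mul]
    have h2 : ∀ k, star (w k) * ∑ l, ∑ m, w l * j (N l m) * star (w m) =
        ∑ m, j (N k m) * star (w m) := by
      intro k
      rw [Finset.mul_sum, Finset.sum_eq_single k]
      · rw [Finset.mul_sum]
        exact Finset.sum_congr rfl fun m _ => by
          rw [← mul_assoc, ← mul_assoc, hw, if_pos rfl, h1]
      · intro l _ hl
        rw [Finset.mul_sum]
        exact Finset.sum_eq_zero fun m _ => by
          rw [← mul_assoc, ← mul_assoc, hw, if_neg hl.symm, zero_mul, zero_mul]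
      · simp
    rw [Finset.sum_mul]
    refine Finset.sum_congr rfl fun i _ => ?_
    rw [Finset.sum_mul]
    simp only [mul_assoc _ (star (w _)), h2, CStarMatrix.mul_apply, map_sum, map_mul,
      Finset.mul_sum, Finset.sum_mul]
    rw [Finset.sum_comm]
    simp only [mul_assoc]
  map_star' M := by
    simp only [star_sum, star_mul, star_star, CStarMatrix.star_apply, map_star]
    rw [Finset.sum_comm]
    simp only [mul_assoc]

theorem matrixUnitsHom_apply (j : E →⋆ₙₐ[ℂ] B) (w : n → B)
    (hw : ∀ i k, star (w i) * w k = if i = k then j 1 else 0) (M : CStarMatrix n n E) :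
    matrixUnitsHom j w hw M = ∑ i, ∑ k, w i * j (M i k) * star (w k) := rfl

theorem matrixUnitsHom_injective (j : E →⋆ₙₐ[ℂ] B) (hj : Function.Injective j) (w : n → B)
    (hw : ∀ i k, star (w i) * w k = if i = k then j 1 else 0) :
    Function.Injective (matrixUnitsHom j w hw) := by
  refine (injective_iff_map_eq_zero _).2 fun M hM => ?_
  ext i k
  have h1 : star (w i) * matrixUnitsHom j w hw M * w k = j (M i k) := by
    rw [matrixUnitsHom_apply, Finset.mul_sum, Finset.sum_mul, Finset.sum_eq_single i]
    · rw [Finset.mul_sum, Finset.sum_mul, Finset.sum_eq_single k]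
      · have : star (w i) * (w i * j (M i k) * star (w k)) * w k =
            (star (w i) * w i) * j (M i k) * (star (w k) * w k) := by simp only [mul_assoc]
        rw [this, hw, hw, if_pos rfl, if_pos rfl, ← map_mul, ← map_mul, one_mul, mul_one]
      · intro l _ hl
        rw [mul_assoc, mul_assoc _ _ (w k), hw, if_neg hl, mul_zero, mul_zero]
      · simp
    · intro l _ hl
      rw [Finset.mul_sum, Finset.sum_mul]
      refine Finset.sum_eq_zero fun m _ => ?_
      rw [← mul_assoc, ← mul_assoc, hw, if_neg hl.symm, zero_mul, zero_mul, zero_mul]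
    · simp
  rw [hM, mul_zero, zero_mul] at h1
  exact (map_eq_zero_iff j hj).1 h1.symm

/-- Partial isometries with orthogonal ranges and a common initial projection `j(1)` generate
together with `j(E)` a copy of `M_n(E)`. -/
theorem exists_subalgebra_of_matrixUnits {B : Type u} [CStarAlgebra B] (j : E →⋆ₙₐ[ℂ] B)
    (hj : Function.Injective j) (w : n → B)
    (hw : ∀ i k, star (w i) * w k = if i = k then j 1 else 0) (hwj : ∀ i, w i * j 1 = w i) :
    ∃ D : UnitalCStarSubalgebra B, D.unit = ∑ i, w i * star (w i) ∧
      (letI := matrixCStarAlgebra n E; Nonempty (D.Carrier ≃⋆ₐ[ℂ] CStarMatrix n n E)) ∧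
      ∀ M : n → n → E, ∑ i, ∑ k, w i * j (M i k) * star (w k) ∈ D.toNonUnitalStarSubalgebra := by
  let _ := matrixCStarAlgebra n E
  refine ⟨.ofInjective (matrixUnitsHom j w hw) (matrixUnitsHom_injective j hj w hw), ?_,
    UnitalCStarSubalgebra.nonempty_starAlgEquiv_ofInjective _ _,
    fun M => ⟨CStarMatrix.ofMatrix M, rfl⟩⟩
  change matrixUnitsHom j w hw 1 = _
  rw [matrixUnitsHom_apply]
  refine Finset.sum_congr rfl fun i _ => ?_
  rw [Finset.sum_eq_single i]
  · rw [CStarMatrix.one_apply, if_pos rfl, hwj]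
  · intro k _ hk
    rw [CStarMatrix.one_apply, if_neg hk.symm, map_zero, mul_zero, zero_mul]
  · simp

end MatrixUnits

/-! ### Corners of the approximating subalgebras -/

section Corner

variable {A : Type u} [CStarAlgebra A]

/-- `r A r` contains a unital copy of a member of `𝒞`, with unit `r`, that approximates the
compressions `r x r` of the elements `x` of `F`. -/
def HasApproximatingCorner (𝒞 : CStarClass.{u}) (F : Finset A) (δ : ℝ) (r : A) : Prop :=
  ∃ (E : Type u) (_ : CStarAlgebra E) (i : E →⋆ₙₐ[ℂ] A), Function.Injective i ∧ i 1 = r ∧ 𝒞 E ∧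
    ∀ x ∈ F, ∃ e : E, ‖r * x * r - i e‖ < δ

/-- The inclusion of a C*-subalgebra. -/
def UnitalCStarSubalgebra.subtype (D : UnitalCStarSubalgebra A) : D.Carrier →⋆ₙₐ[ℂ] A where
  toFun x := x.1
  map_smul' _ _ := rfl
  map_zero' := rfl
  map_add' _ _ := rfl
  map_mul' _ _ := rfl
  map_star' _ := rfl

theorem UnitalCStarSubalgebra.subtype_injective (D : UnitalCStarSubalgebra A) :
    Function.Injective D.subtype := fun _ _ h => Subtype.ext h

/-- A tracial approximation of a simple algebra can be cut down by a given projection `p`: the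
approximating subalgebra contains a projection `r` close to `q p`, where `q` is its unit. -/
theorem TA.exists_corner {𝒞 : CStarClass.{u}}
    (h_corner : ∀ (B : Type u) [CStarAlgebra B] (p : B) (hp : IsStarProjection p),
      p ≠ 0 → 𝒞 B → 𝒞 (UnitalCStarSubalgebra.corner p hp).Carrier)
    (hTA : TA 𝒞 A) (hA : IsSimple A) (F : Finset A) {δ : ℝ} (hδ : 0 < δ) {c p : A}
    (hc : IsPositive c) (hc0 : c ≠ 0) (hp : IsStarProjection p) (hp0 : p ≠ 0) :
    ∃ q r : A, IsStarProjection q ∧ IsStarProjection r ∧ r ≠ 0 ∧ ‖r - q * p‖ < δ ∧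
      ‖q * p - p * q‖ < δ ∧ (∀ x ∈ F, ‖q * x - x * q‖ < δ) ∧ CuntzLE (1 - q) c ∧
      HasApproximatingCorner 𝒞 F δ r := by
  classical
  obtain ⟨F₀, κ, hκ, hF₀⟩ := hA.exists_le_norm_mul hp0
  set ε := min (δ / 13) (min (κ / 13) (1 / 50)) with hε
  have hε0 : 0 < ε := by positivity
  have hεδ : 13 * ε ≤ δ := by
    have : ε ≤ δ / 13 := min_le_left _ _
    linarith
  have hεκ : 13 * ε ≤ κ := by
    have : ε ≤ κ / 13 := (min_le_right _ _).trans (min_le_left _ _)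
    linarith
  have hε1 : ε ≤ 1 / 50 := (min_le_right _ _).trans (min_le_right _ _)
  obtain ⟨q, D, hq, hq0, hDq, hD, hcomm, happ, hqc⟩ := hTA (insert p (F₀ ∪ F)) ε c hε0 hc hc0
  have hcomm_p : ‖q * p - p * q‖ < ε := hcomm p (Finset.mem_insert_self _ _)
  have hlow : κ ≤ ‖q * p‖ := hF₀ q hq hq0 fun x hx =>
    (hcomm x (Finset.mem_insert_of_mem (Finset.mem_union_left _ hx))).trans (by linarith)
  have hqq := hq.isIdempotentElem.eq
  have hqn := IsStarProjection.norm_le_one hq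
  have hpn := IsStarProjection.norm_le_one hp
  set b := q * p * q with hb
  have hbs : star b = b := by
    simp [hb, hq.isSelfAdjoint.star_eq, hp.isSelfAdjoint.star_eq, mul_assoc]
  have hbn : ‖b‖ ≤ 1 := by
    calc _ ≤ ‖q‖ * ‖p‖ * ‖q‖ := norm_mul₃_le
      _ ≤ 1 * 1 * 1 := by gcongr
      _ = 1 := by norm_num
  have hbq : ‖b - q * p‖ < ε := by
    have : b - q * p = q * (p * q - q * p) := by
      rw [hb, mul_sub, ← mul_assoc, ← mul_assoc, hqq]
    rw [this]
    calc _ ≤ 1 * ‖p * q - q * p‖ := (norm_mul_le _ _).trans (by gcongr)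
      _ < ε := by rw [one_mul, norm_sub_rev]; exact hcomm_p
  have hbb : ‖b * b - b‖ < ε := by
    have : b * b - b = q * p * (q * p - p * q) * q := by
      have h1 : q * p * (q * p - p * q) * q = q * p * q * p * q - q * (p * p) * (q * q) := by
        noncomm_ring
      have h2 : b * b = q * p * (q * q) * p * q := by rw [hb]; noncomm_ring
      rw [h1, h2, hqq, hp.isIdempotentElem.eq]
    rw [this]
    calc _ ≤ ‖q * p‖ * ‖q * p - p * q‖ * ‖q‖ := norm_mul₃_le
      _ ≤ 1 * 1 * ‖q * p - p * q‖ * 1 := by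
        have h1 : ‖q * p‖ ≤ 1 * 1 := (norm_mul_le _ _).trans (by gcongr)
        gcongr
      _ < ε := by simpa using hcomm_p
  -- the self-adjoint part of an approximant of `b` in `D` is almost idempotent
  obtain ⟨d₀, hd₀, hd₀n⟩ := happ p (Finset.mem_insert_self _ _)
  let d : D.Carrier := ((1 / 2 : ℝ) : ℂ) • (⟨d₀, hd₀⟩ + star ⟨d₀, hd₀⟩)
  have hds : IsSelfAdjoint d := by
    rw [IsSelfAdjoint, star_smul, star_add, star_star, RCLike.star_def, Complex.conj_ofReal,
      add_comm]
  have hdv : (d : A) = ((1 / 2 : ℝ) : ℂ) • (d₀ + star d₀) := rfl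
  have hdb : ‖b - d‖ < ε := by
    have h1 : b - d = ((1 / 2 : ℝ) : ℂ) • ((b - d₀) + star (b - d₀)) := by
      have h2 : (b - d₀) + star (b - d₀) = (2 : ℂ) • b - (d₀ + star d₀) := by
        rw [star_sub, hbs, two_smul]; abel
      rw [h2, smul_sub, smul_smul, hdv]
      norm_num
    rw [h1, norm_smul, Complex.norm_real, Real.norm_eq_abs, abs_of_pos (by norm_num)]
    have := norm_add_le (b - d₀) (star (b - d₀))
    rw [norm_star] at this
    linarith
  have hdn : ‖(d : A)‖ ≤ 2 := by
    have := norm_sub_norm_le (d : A) b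
    rw [norm_sub_rev] at this
    linarith
  have hdd : ‖d * d - d‖ ≤ 5 * ε := by
    change ‖(d : A) * d - d‖ ≤ 5 * ε
    have h1 : (d : A) * d - d = (b * b - b) - (b - d) * d - b * (b - d) + (b - d) := by
      noncomm_ring
    have h2 : ‖(b - d) * (d : A)‖ ≤ ε * 2 := (norm_mul_le _ _).trans (by gcongr)
    have h3 : ‖b * (b - (d : A))‖ ≤ 1 * ε := (norm_mul_le _ _).trans (by gcongr)
    rw [h1]
    have h4 := norm_add_le ((b * b - b) - (b - d) * d - b * (b - d)) (b - (d : A))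
    have h5 := norm_sub_le ((b * b - b) - (b - d) * d) (b * (b - (d : A)))
    have h6 := norm_sub_le (b * b - b) ((b - d) * (d : A))
    linarith
  obtain ⟨r, hr, hrd⟩ := exists_isStarProjection_near hds (by linarith) hdd
  have hrd' : ‖(r : A) - d‖ ≤ 2 * (5 * ε) := hrd
  have hrA : IsStarProjection (r : A) :=
    ⟨congrArg Subtype.val hr.isIdempotentElem, congrArg Subtype.val hr.isSelfAdjoint⟩
  -- `r` is nonzero because `q p` is bounded below independently of `ε`
  have hrqp : ‖(r : A) - q * p‖ < 13 * ε := by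
    have h1 : (r : A) - q * p = (r - d) - (b - d) + (b - q * p) := by abel
    rw [h1]
    have h2 := norm_add_le ((r - d) - (b - d) : A) (b - q * p)
    have h3 := norm_sub_le ((r : A) - d) (b - d)
    linarith
  have hr0' : (r : A) ≠ 0 := by
    intro h
    rw [h, zero_sub, norm_neg] at hrqp
    linarith
  have hr0 : r ≠ 0 := fun h => hr0' (congrArg Subtype.val h)
  have hrq : (r : A) * q = r := by rw [← hDq]; exact D.mul_unit' _ r.2
  have hqr : q * (r : A) = r := by rw [← hDq]; exact D.unit_mul' _ r.2
  refine ⟨q, r, hq, hrA, hr0', by linarith, by linarith, fun x hx => ?_, hqc,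
    (UnitalCStarSubalgebra.corner r hr).Carrier, inferInstance,
    D.subtype.comp (UnitalCStarSubalgebra.corner r hr).subtype,
    D.subtype_injective.comp (UnitalCStarSubalgebra.corner r hr).subtype_injective, rfl,
    h_corner _ r hr hr0 hD, fun x hx => ?_⟩
  · exact (hcomm x (Finset.mem_insert_of_mem (Finset.mem_union_right _ hx))).trans (by linarith)
  · obtain ⟨y, hy, hyn⟩ := happ x (Finset.mem_insert_of_mem (Finset.mem_union_right _ hx))
    refine ⟨⟨r * ⟨y, hy⟩ * r, ⟨y, hy⟩, rfl⟩, ?_⟩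
    change ‖(r : A) * x * r - r * y * r‖ < δ
    have h1 : (r : A) * x * r - r * y * r = r * (q * x * q - y) * r := by
      have h2 : (r : A) * (q * x * q - y) * r = (r * q) * x * (q * r) - r * y * r := by
        noncomm_ring
      rw [h2, hrq, hqr]
    have hrn := IsStarProjection.norm_le_one hrA
    rw [h1]
    calc _ ≤ ‖(r : A)‖ * ‖q * x * q - y‖ * ‖(r : A)‖ := norm_mul₃_le
      _ ≤ 1 * ‖q * x * q - y‖ * 1 := by gcongr
      _ < δ := by rw [one_mul, mul_one]; linarith

end Corner

/-! ### Approximate matrix units in the crossed product -/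

section MatrixUnitsCrossedProduct

variable {G : Type v} [Group G] [Fintype G] {A : Type u} [CStarAlgebra A]
  {α : G →* (A ≃⋆ₐ[ℂ] A)}

open CrossedProduct

section Algebra

variable (α) {T : Type*} [Ring T] {U : G → T} {R : T} {X : A → T}

/-- The sum of the conjugates of `R` commutes with every element of the crossed product whose
twisted coefficients commute with `R`. -/
theorem sum_conj_mul_comm (hUU : ∀ g h, U g * U h = U (g * h))
    (hUX : ∀ g x, U g * X x = X (α g x) * U g) (Y : G → A)
    (hRX : ∀ g k, R * X (α g⁻¹ (Y k)) = X (α g⁻¹ (Y k)) * R) :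
    (∑ g, U g * R * U g⁻¹) * ∑ k, X (Y k) * U k =
      (∑ k, X (Y k) * U k) * ∑ g, U g * R * U g⁻¹ := by
  have hRU : ∀ g k, R * (U g⁻¹ * X (Y k)) = X (α g⁻¹ (Y k)) * R * U g⁻¹ := by
    intro g k
    rw [hUX, ← mul_assoc, hRX]
  have hUX' : ∀ g k, U g * X (α g⁻¹ (Y k)) = X (Y k) * U g := by
    intro g k
    rw [hUX, ← map_mul_apply', mul_inv_cancel, map_one_apply']
  rw [Finset.sum_mul_sum, Finset.sum_mul_sum, Finset.sum_comm]
  refine Finset.sum_congr rfl fun k _ => ?_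
  refine Fintype.sum_equiv (Equiv.mulLeft k⁻¹) _ _ fun g => ?_
  rw [Equiv.coe_mulLeft]
  calc U g * R * U g⁻¹ * (X (Y k) * U k) = U g * (R * (U g⁻¹ * X (Y k))) * U k := by
        simp only [mul_assoc]
    _ = (U g * X (α g⁻¹ (Y k))) * R * (U g⁻¹ * U k) := by rw [hRU]; simp only [mul_assoc]
    _ = X (Y k) * U g * R * U (g⁻¹ * k) := by rw [hUX', hUU]
    _ = X (Y k) * U k * (U (k⁻¹ * g) * R * U (k⁻¹ * g)⁻¹) := by
      rw [mul_inv_rev, inv_inv, ← mul_assoc, ← mul_assoc, mul_assoc (X (Y k)) (U k), hUU,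
        mul_inv_cancel_left]

/-- If `R` is orthogonal to its conjugates, the matrix entries of an element of the crossed product
with respect to the partial isometries `U_g R` are compressions of its twisted coefficients. -/
theorem compression_eq (hU1 : U 1 = 1) (hUU : ∀ g h, U g * U h = U (g * h))
    (hUX : ∀ g x, U g * X x = X (α g x) * U g) (hRUR : ∀ m, m ≠ 1 → R * U m * R = 0)
    (Y : G → A) {g : G} (hRX : ∀ k, R * X (α g⁻¹ (Y k)) = X (α g⁻¹ (Y k)) * R) (h : G) :
    R * U g⁻¹ * (∑ k, X (Y k) * U k) * (U h * R) = R * X (α g⁻¹ (Y (g * h⁻¹))) * R := by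
  have hRU : ∀ k, R * (U g⁻¹ * X (Y k)) = X (α g⁻¹ (Y k)) * R * U g⁻¹ := by
    intro k
    rw [hUX, ← mul_assoc, hRX]
  have hterm : ∀ k, R * U g⁻¹ * (X (Y k) * U k) * (U h * R) =
      X (α g⁻¹ (Y k)) * (R * U (g⁻¹ * k * h) * R) := by
    intro k
    calc R * U g⁻¹ * (X (Y k) * U k) * (U h * R)
        = R * (U g⁻¹ * X (Y k)) * (U k * U h) * R := by simp only [mul_assoc]
      _ = X (α g⁻¹ (Y k)) * (R * (U g⁻¹ * U (k * h)) * R) := by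
          rw [hRU, hUU]; simp only [mul_assoc]
      _ = _ := by rw [hUU, mul_assoc g⁻¹]
  rw [Finset.mul_sum, Finset.sum_mul, Finset.sum_eq_single (g * h⁻¹)]
  · have h1 : g⁻¹ * (g * h⁻¹) * h = 1 := by group
    rw [hterm, h1, hU1, mul_one, ← mul_assoc, ← hRX]
  · intro k _ hk
    rw [hterm, hRUR, mul_zero]
    intro hm
    apply hk
    rw [← mul_one g, ← hm]
    group
  · simp

end Algebra

set_option maxHeartbeats 800000 in
/-- Partial isometries `w_g = p_g u_g s_g` with `s_g = r (r α_{g⁻¹}(p_g) r)^{-1/2}` in `r A r`. They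
have orthogonal ranges, because `p_g p_h = 0`, and the common initial projection `r`. Asymptotically
`w_g = u_g r`, so that the projection `∑ w_g w_g⋆` commutes with a given element `Y`, compresses it
into `∑ w_g (r A r) w_h⋆`, and `p_g - w_g w_g⋆` becomes a conjugate of `1 - q`. -/
theorem exists_partialIsometries [DecidableEq G] {F : Finset A} {p : ℕ → G → A}
    (hp : ∀ n : ℕ, IsRokhlinFamily α F (1 / ((n : ℝ) + 1)) (p n)) {q r : ℕ → A}
    (hq : ∀ n, IsStarProjection (q n)) (hr : ∀ n, IsStarProjection (r n))
    (hrq : ∀ n : ℕ, ‖r n - q n * p n 1‖ < 1 / ((n : ℝ) + 1))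
    (hqp : ∀ n : ℕ, ‖q n * p n 1 - p n 1 * q n‖ < 1 / ((n : ℝ) + 1))
    (hqF : ∀ n : ℕ, ∀ x ∈ F, ‖q n * x - x * q n‖ < 1 / ((n : ℝ) + 1)) :
    ∃ w : ℕ → G → CrossedProduct α,
      (∀ᶠ n in atTop, ∀ g h, star (w n g) * w n h = if g = h then incl α (r n) else 0) ∧
      (∀ n g, w n g * incl α (r n) = w n g) ∧
      (∀ n g, incl α (p n g) * w n g = w n g) ∧
      (∀ Y : CrossedProduct α, (∀ g k, α g⁻¹ (Y k) ∈ F) →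
        Tendsto (fun n => ‖(∑ g, w n g * star (w n g)) * Y - Y * ∑ g, w n g * star (w n g)‖)
          atTop (𝓝 0) ∧
        Tendsto (fun n => ‖(∑ g, w n g * star (w n g)) * Y * (∑ g, w n g * star (w n g)) -
          ∑ g, ∑ h, w n g * incl α (r n * α g⁻¹ (Y (g * h⁻¹)) * r n) * star (w n h)‖)
          atTop (𝓝 0)) ∧
      ∀ g, Tendsto (fun n => ‖(incl α (p n g) - w n g * star (w n g)) -
        (unitary α g * incl α (p n 1)) * incl α (1 - q n) *
          star (unitary α g * incl α (p n 1))‖) atTop (𝓝 0) := by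
  -- relations between the sequences in the coefficient algebra
  let qS : boundedSeq A := projSeq q hq
  let rS : boundedSeq A := projSeq r hr
  let pS : G → boundedSeq A := rokhlinSeq hp
  let αS : G → boundedSeq A →+* boundedSeq A := fun g => mapSeq (StarAlgHomClass.toStarAlgHom (α g))
  have hrr : rS * rS = rS := Subtype.ext (funext fun n => (hr n).isIdempotentElem)
  have hrq' : seqClass rS = seqClass qS * seqClass (pS 1) := by
    rw [← map_mul, seqClass_eq_iff]
    exact tendsto_zero_of_lt_one_div (fun _ => norm_nonneg _) hrq
  have hqp' : seqClass qS * seqClass (pS 1) = seqClass (pS 1) * seqClass qS := by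
    rw [← map_mul, ← map_mul, seqClass_eq_iff]
    exact tendsto_zero_of_lt_one_div (fun _ => norm_nonneg _) hqp
  have hαp : ∀ g, seqClass (αS g⁻¹ (pS g)) = seqClass (pS 1) := by
    intro g
    rw [seqClass_eq_iff]
    refine tendsto_zero_of_lt_one_div (fun _ => norm_nonneg _) fun n => ?_
    have := (hp n).shift g⁻¹ g
    rwa [inv_mul_cancel] at this
  -- the element to be inverted, and its inverse square root
  let tS : G → boundedSeq A := fun g => rS * αS g⁻¹ (pS g) * rS + (1 - rS)
  have ht1 : ∀ g, seqClass (tS g) = 1 := by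
    intro g
    have h1 : seqClass rS * seqClass (pS 1) = seqClass rS := by
      rw [hrq', mul_assoc, ← map_mul, rokhlinSeq_mul_self]
    have h2 : seqClass rS * seqClass rS = seqClass rS := by rw [← map_mul, hrr]
    simp only [tS, map_add, map_mul, map_sub, map_one, hαp, h1, h2]
    abel
  have ht_lim : ∀ g, Tendsto (fun n => ‖(tS g).1 n - 1‖) atTop (𝓝 0) := fun g => by
    have := ht1 g
    rw [← map_one seqClass, seqClass_eq_iff] at this
    exact this
  have ht_sa : ∀ n g, IsSelfAdjoint ((tS g).1 n) := by
    intro n g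
    change IsSelfAdjoint (r n * α g⁻¹ (p n g) * r n + (1 - r n))
    refine IsSelfAdjoint.add ?_ ((hr n).one_sub).isSelfAdjoint
    rw [IsSelfAdjoint, star_mul, star_mul, (hr n).isSelfAdjoint.star_eq, ← map_star,
      ((hp n).proj g).isSelfAdjoint.star_eq, mul_assoc]
  have ht_comm : ∀ n g, Commute ((tS g).1 n) (r n) := by
    intro n g
    change (r n * α g⁻¹ (p n g) * r n + (1 - r n)) * r n =
      r n * (r n * α g⁻¹ (p n g) * r n + (1 - r n))
    have := (hr n).isIdempotentElem.eq
    simp only [add_mul, mul_add, sub_mul, mul_sub, one_mul, mul_one, this, sub_self, add_zero,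
      ← mul_assoc]
    simp only [mul_assoc, this]
  have ht_r : ∀ n g, r n * α g⁻¹ (p n g) * r n = (tS g).1 n * r n := by
    intro n g
    change _ = (r n * α g⁻¹ (p n g) * r n + (1 - r n)) * r n
    have := (hr n).isIdempotentElem.eq
    rw [add_mul, sub_mul, one_mul, this, sub_self, add_zero, mul_assoc _ (r n) (r n), this]
  choose s hs_sa hs_norm hs_comm hs_inv using fun n g => exists_inv_sqrt (ht_sa n g)
  have hs_r : ∀ n g, Commute (s n g) (r n) := fun n g => hs_comm n g _ (ht_comm n g)
  have hs_bdd : ∀ g, ∃ C : ℝ, ∀ n, ‖s n g‖ ≤ C := by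
    intro g
    obtain ⟨C, hC⟩ := (tS g - 1).2
    refine ⟨C + ‖(1 : A)‖, fun n => ?_⟩
    have h1 : s n g = (s n g - 1) + 1 := by abel
    rw [h1]
    exact (norm_add_le _ _).trans (add_le_add ((hs_norm n g).trans (hC n)) le_rfl)
  let sS : G → boundedSeq A := fun g => ⟨fun n => s n g, hs_bdd g⟩
  have hs1 : ∀ g, seqClass (sS g) = 1 := by
    intro g
    rw [← map_one seqClass, seqClass_eq_iff]
    exact squeeze_zero (fun _ => norm_nonneg _) (fun n => hs_norm n g) (ht_lim g)
  -- the partial isometries and their adjoints, as sequences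
  let B := CrossedProduct α
  let uS : G → boundedSeq B := fun g => constSeq (unitary α g)
  let ι : boundedSeq A →+* boundedSeq B := mapSeq (incl α)
  let W : G → boundedSeq B := fun g => ι (pS g) * uS g * ι (rS * sS g)
  let V : G → boundedSeq B := fun g => ι (sS g * rS) * uS g⁻¹ * ι (pS g)
  have hWV : ∀ n g, star ((W g).1 n) = (V g).1 n := by
    intro n g
    change star (incl α (p n g) * unitary α g * incl α (r n * s n g)) =
      incl α (s n g * r n) * unitary α g⁻¹ * incl α (p n g)
    rw [star_mul, star_mul, star_unitary, ← map_star, ← map_star, star_mul,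
      (hr n).isSelfAdjoint.star_eq, (hs_sa n g).star_eq, ((hp n).proj g).isSelfAdjoint.star_eq,
      mul_assoc]
  -- their classes
  let P : G → SeqAlg B := fun g => seqClass (ι (pS g))
  let Q : SeqAlg B := seqClass (ι qS)
  let R : SeqAlg B := seqClass (ι rS)
  let U : G → SeqAlg B := fun g => seqClass (uS g)
  let X : A → SeqAlg B := fun x => seqClass (ι (constSeq x))
  have push : ∀ {x y : boundedSeq A}, seqClass x = seqClass y → seqClass (ι x) = seqClass (ι y) :=
    fun h => mapClass_eq (incl α) (seqClass_eq_iff.1 h)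
  have hPP : ∀ g, P g * P g = P g := fun g => by
    simp only [P]; rw [← map_mul, ← map_mul, rokhlinSeq_mul_self]
  have hPne : ∀ g h, g ≠ h → P g * P h = 0 := fun g h hgh => by
    simp only [P]; rw [← map_mul, ← map_mul, rokhlinSeq_mul_of_ne hp hgh, map_zero, map_zero]
  have hRR : R * R = R := by simp only [R]; rw [← map_mul, ← map_mul, hrr]
  have hRQP : R = Q * P 1 := by
    simp only [R, Q, P]
    rw [← map_mul, ← map_mul]
    exact push (by rw [hrq', map_mul])
  have hQP : Q * P 1 = P 1 * Q := by
    simp only [Q, P]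
    rw [← map_mul, ← map_mul, ← map_mul, ← map_mul]
    exact push (by rw [map_mul, map_mul, hqp'])
  have hRP : R * P 1 = R := by rw [hRQP, mul_assoc, hPP]
  have hPR : P 1 * R = R := by rw [hRQP, hQP, ← mul_assoc, hPP]
  have hUU : ∀ g h, U g * U h = U (g * h) := fun g h => by
    simp only [U, uS]; rw [← map_mul, ← map_mul, unitary_mul_unitary]
  have hU1 : U 1 = 1 := by simp only [U, uS]; rw [unitary_one, map_one, map_one]
  have hUP : ∀ g h, U g * P h = P (g * h) * U g := fun g h =>
    constSeq_mul_rokhlinSeq (φ := incl α) unitary_mul_incl hp g h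
  have hUX : ∀ g x, U g * X x = X (α g x) * U g := fun g x =>
    constSeq_mul_mapClass (φ := incl α) unitary_mul_incl g (constSeq x)
  have hRX : ∀ x ∈ F, R * X x = X x * R := by
    intro x hx
    have h1 : P 1 * X x = X x * P 1 := mapClass_rokhlinSeq_comm hp 1 hx
    have h2 : Q * X x = X x * Q := by
      simp only [Q, X]
      rw [← map_mul, ← map_mul, ← map_mul, ← map_mul]
      refine push (seqClass_eq_iff.2 ?_)
      exact tendsto_zero_of_lt_one_div (fun _ => norm_nonneg _) fun n => hqF n x hx
    rw [hRQP, mul_assoc, h1, ← mul_assoc, h2, mul_assoc]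
  -- for `m ≠ 1`, `u_m` moves `p_1` to the orthogonal projection `p_m`
  have hRUR : ∀ m, m ≠ 1 → R * U m * R = 0 := by
    intro m hm
    calc R * U m * R = R * P 1 * U m * (P 1 * R) := by rw [hRP, hPR]
      _ = R * (P 1 * (U m * P 1)) * R := by simp only [mul_assoc]
      _ = R * (P 1 * P m * U m) * R := by rw [hUP, mul_one, mul_assoc (P 1)]
      _ = 0 := by rw [hPne 1 m hm.symm, zero_mul, mul_zero, zero_mul]
  have hsR : ∀ g, seqClass (ι (sS g)) = 1 := fun g => by
    rw [push ((hs1 g).trans (map_one seqClass).symm), map_one, map_one]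
  have hW : ∀ g, seqClass (W g) = U g * R := by
    intro g
    have h1 : seqClass (W g) = P g * U g * R := by
      simp only [W, map_mul, hsR, mul_one]; rfl
    have h2 := hUP g 1
    rw [mul_one] at h2
    rw [h1, ← h2, mul_assoc, hPR]
  have hV : ∀ g, seqClass (V g) = R * U g⁻¹ := by
    intro g
    have h1 : seqClass (V g) = R * U g⁻¹ * P g := by
      simp only [V, map_mul, hsR, one_mul]; rfl
    have h2 := hUP g⁻¹ g
    rw [inv_mul_cancel] at h2
    rw [h1, mul_assoc, h2, ← mul_assoc, hRP]
  have hY : ∀ Y : CrossedProduct α, seqClass (constSeq Y) = ∑ k, X (Y k) * U k := by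
    intro Y
    conv_lhs => rw [eq_sum_incl_mul_unitary Y]
    rw [map_sum, map_sum]
    exact Finset.sum_congr rfl fun g _ => by rw [map_mul, map_mul]; rfl
  refine ⟨fun n g => (W g).1 n, ?_, ?_, ?_, ?_, ?_⟩
  · -- exact orthogonality, as soon as the inverse square roots exist
    have hev : ∀ᶠ n in atTop, ∀ g, ‖(tS g).1 n - 1‖ < 1 / 2 :=
      eventually_all.2 fun g => (ht_lim g).eventually (gt_mem_nhds (by norm_num))
    filter_upwards [hev] with n hn g h
    rw [hWV]
    change incl α (s n g * r n) * unitary α g⁻¹ * incl α (p n g) *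
      (incl α (p n h) * unitary α h * incl α (r n * s n h)) = _
    have h0 : incl α (s n g * r n) * unitary α g⁻¹ * incl α (p n g) *
        (incl α (p n h) * unitary α h * incl α (r n * s n h)) =
        incl α (s n g * r n) * (unitary α g⁻¹ * incl α (p n g * p n h)) * unitary α h *
          incl α (r n * s n h) := by
      rw [map_mul (incl α) (p n g) (p n h)]
      simp only [mul_assoc]
    rw [h0]
    split_ifs with hgh
    · subst hgh
      have h1 : unitary α g⁻¹ * incl α (p n g) * unitary α g = incl α (α g⁻¹ (p n g)) := by
        rw [unitary_mul_incl, mul_assoc, unitary_mul_unitary, inv_mul_cancel, unitary_one, mul_one]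
      rw [((hp n).proj g).isIdempotentElem.eq, mul_assoc (incl α (s n g * r n)), h1, ← map_mul,
        ← map_mul]
      congr 1
      calc s n g * r n * α g⁻¹ (p n g) * (r n * s n g)
          = s n g * (r n * α g⁻¹ (p n g) * r n) * s n g := by simp only [mul_assoc]
        _ = s n g * (tS g).1 n * s n g * r n := by
          rw [ht_r, mul_assoc, mul_assoc, ← (hs_r n g).eq]; simp only [mul_assoc]
        _ = r n := by rw [hs_inv n g (hn g).le, one_mul]
    · rw [(hp n).orth g h hgh, map_zero, mul_zero, mul_zero, zero_mul, zero_mul]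
  · intro n g
    change incl α (p n g) * unitary α g * incl α (r n * s n g) * incl α (r n) =
      incl α (p n g) * unitary α g * incl α (r n * s n g)
    rw [mul_assoc, ← map_mul, mul_assoc (r n), (hs_r n g).eq, ← mul_assoc (r n),
      (hr n).isIdempotentElem.eq]
  · intro n g
    change incl α (p n g) * (incl α (p n g) * unitary α g * incl α (r n * s n g)) =
      incl α (p n g) * unitary α g * incl α (r n * s n g)
    rw [← mul_assoc, ← mul_assoc, ← map_mul, ((hp n).proj g).isIdempotentElem.eq]
  · intro Y hYF
    have hq_cls : seqClass (∑ g, W g * V g) = ∑ g, U g * R * U g⁻¹ := by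
      rw [map_sum]
      refine Finset.sum_congr rfl fun g _ => ?_
      rw [map_mul, hW, hV]
      calc U g * R * (R * U g⁻¹) = U g * (R * R) * U g⁻¹ := by simp only [mul_assoc]
        _ = _ := by rw [hRR]
    have hval : ∀ n, (∑ g, W g * V g).1 n = ∑ g, (W g).1 n * star ((W g).1 n) := by
      intro n
      simp only [hWV, AddSubmonoidClass.coe_finsetSum, Finset.sum_apply]
      rfl
    constructor
    · have key : seqClass ((∑ g, W g * V g) * constSeq Y) =
          seqClass (constSeq Y * ∑ g, W g * V g) := by
        rw [map_mul, map_mul, hq_cls, hY]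
        exact sum_conj_mul_comm α hUU hUX Y fun g k => hRX _ (hYF g k)
      have := seqClass_eq_iff.1 key
      refine this.congr fun n => ?_
      rw [← hval]; rfl
    · have key : seqClass ((∑ g, W g * V g) * constSeq Y * (∑ g, W g * V g)) =
          seqClass (∑ g, ∑ h, W g * ι (rS * constSeq (α g⁻¹ (Y (g * h⁻¹))) * rS) * V h) := by
        have hVYW : ∀ g h, seqClass (V g) * seqClass (constSeq Y) * seqClass (W h) =
            R * X (α g⁻¹ (Y (g * h⁻¹))) * R := by
          intro g h
          rw [hV, hW, hY]
          exact compression_eq α hU1 hUU hUX hRUR Y (fun k => hRX _ (hYF g k)) h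
        rw [map_mul, map_mul, map_sum, map_sum, Finset.sum_mul, Finset.sum_mul]
        refine Finset.sum_congr rfl fun g _ => ?_
        rw [map_sum, Finset.mul_sum]
        refine Finset.sum_congr rfl fun h _ => ?_
        simp only [map_mul]
        calc seqClass (W g) * seqClass (V g) * seqClass (constSeq Y) *
              (seqClass (W h) * seqClass (V h))
            = seqClass (W g) * (seqClass (V g) * seqClass (constSeq Y) * seqClass (W h)) *
              seqClass (V h) := by simp only [mul_assoc]
          _ = _ := by rw [hVYW]
      have := seqClass_eq_iff.1 key
      refine this.congr fun n => ?_
      rw [← hval]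
      have h2 : (∑ g, ∑ h, W g * ι (rS * constSeq (α g⁻¹ (Y (g * h⁻¹))) * rS) * V h).1 n =
          ∑ g, ∑ h, (W g).1 n * incl α (r n * α g⁻¹ (Y (g * h⁻¹)) * r n) * star ((W h).1 n) := by
        simp only [hWV, AddSubmonoidClass.coe_finsetSum, Finset.sum_apply]
        rfl
      rw [← h2]
      rfl
  · intro g
    have key : seqClass (ι (pS g) - W g * V g) =
        seqClass (uS g * ι (pS 1) * ι (1 - qS) * (ι (pS 1) * uS g⁻¹)) := by
      simp only [map_sub, map_mul, map_one, hW, hV]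
      change P g - U g * R * (R * U g⁻¹) = U g * P 1 * (1 - Q) * (P 1 * U g⁻¹)
      have h1 : P g = U g * P 1 * U g⁻¹ := by
        rw [hUP, mul_assoc, hUU, mul_inv_cancel, hU1, mul_one, mul_one]
      have h2 : U g * R * (R * U g⁻¹) = U g * (R * R) * U g⁻¹ := by simp only [mul_assoc]
      have h3 : U g * P 1 * (1 - Q) * (P 1 * U g⁻¹) =
          U g * (P 1 * P 1) * U g⁻¹ - U g * (P 1 * (Q * P 1)) * U g⁻¹ := by noncomm_ring
      rw [h1, h2, h3, hRR, hPP, ← hRQP, hPR]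
    have := seqClass_eq_iff.1 key
    refine this.congr fun n => ?_
    rw [hWV, star_mul, star_unitary, ← map_star, ((hp n).proj 1).isSelfAdjoint.star_eq]
    rfl

end MatrixUnitsCrossedProduct

/-! ### Tracial approximation of the crossed product -/

section Main

/-- A matrix algebra over a member of `𝒞`, realized in `B` by partial isometries that are indexed
by an arbitrary finite type, is a member of `𝒞`. -/
theorem exists_subalgebra_mem_class {𝒞 : CStarClass.{u}}
    (h_iso : ∀ (B C : Type u) [CStarAlgebra B] [CStarAlgebra C],
      𝒞 B → Nonempty (C ≃⋆ₐ[ℂ] B) → 𝒞 C)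
    (h_matrix : ∀ (B : Type u) [CStarAlgebra B] (n : ℕ), 1 ≤ n → 𝒞 B →
      @𝒞 (CStarMatrix (Fin n) (Fin n) B) (matrixCStarAlgebra (Fin n) B))
    {G : Type*} [Fintype G] [Nonempty G] [DecidableEq G] {E B : Type u} [CStarAlgebra E]
    [CStarAlgebra B] (hE : 𝒞 E) (j : E →⋆ₙₐ[ℂ] B) (hj : Function.Injective j) (w : G → B)
    (hw : ∀ g h, star (w g) * w h = if g = h then j 1 else 0) (hwj : ∀ g, w g * j 1 = w g) :
    ∃ D : UnitalCStarSubalgebra B, D.unit = ∑ g, w g * star (w g) ∧ 𝒞 D.Carrier ∧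
      ∀ M : G → G → E, ∑ g, ∑ h, w g * j (M g h) * star (w h) ∈ D.toNonUnitalStarSubalgebra := by
  let e : Fin (Fintype.card G) ≃ G := (Fintype.equivFin G).symm
  obtain ⟨D, hD1, hD2, hD3⟩ := exists_subalgebra_of_matrixUnits j hj (fun i => w (e i))
    (fun i k => by simp only [hw, e.apply_eq_iff_eq]) (fun i => hwj (e i))
  refine ⟨D, ?_, ?_, fun M => ?_⟩
  · rw [hD1]
    exact e.sum_comp fun g => w g * star (w g)
  · let _ := matrixCStarAlgebra (Fin (Fintype.card G)) E
    exact h_iso _ _ (h_matrix E _ Fintype.card_pos hE) hD2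
  · have h1 := hD3 fun i k => M (e i) (e k)
    have h2 : ∑ i, ∑ k, w (e i) * j (M (e i) (e k)) * star (w (e k)) =
        ∑ g, ∑ h, w g * j (M g h) * star (w h) := by
      rw [← e.sum_comp]
      exact Finset.sum_congr rfl fun i _ =>
        e.sum_comp fun h => w (e i) * j (M (e i) h) * star (w h)
    rwa [h2] at h1

/-- Algebra of partial isometries `w_g` under orthogonal projections `p_g`: the projection
`∑ w_g w_g⋆` and the remainders `p_g - w_g w_g⋆`. -/
theorem isStarProjection_of_partialIsometries {B G : Type*} [CStarAlgebra B] [Fintype G]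
    [DecidableEq G] {p w : G → B} {r : B} (hp : ∀ g, IsStarProjection (p g))
    (ho : ∀ g h, g ≠ h → p g * p h = 0)
    (hw : ∀ g h, star (w g) * w h = if g = h then r else 0) (hwr : ∀ g, w g * r = w g)
    (hpw : ∀ g, p g * w g = w g) :
    IsStarProjection (∑ g, w g * star (w g)) ∧
      (∀ g, IsStarProjection (p g - w g * star (w g))) ∧
      (∀ g h, g ≠ h → (p g - w g * star (w g)) * (p h - w h * star (w h)) = 0) ∧
      ∀ g, (p g - w g * star (w g)) * (1 - ∑ g, p g) = 0 := by
  have hw1 : ∀ g, IsStarProjection (w g * star (w g)) := fun g => by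
    refine ⟨?_, .mul_star_self _⟩
    rw [IsIdempotentElem, mul_assoc, ← mul_assoc (star (w g)), hw, if_pos rfl, ← mul_assoc, hwr]
  have hw0 : ∀ g h, g ≠ h → w g * star (w g) * (w h * star (w h)) = 0 := fun g h hgh => by
    rw [mul_assoc, ← mul_assoc (star (w g)), hw, if_neg hgh, zero_mul, mul_zero]
  have hwp : ∀ g, star (w g) * p g = star (w g) := fun g => by
    rw [← star_inj, star_mul, star_star, (hp g).isSelfAdjoint.star_eq, hpw]
  have hep : ∀ g, (p g - w g * star (w g)) * p g = p g - w g * star (w g) := fun g => by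
    rw [sub_mul, (hp g).isIdempotentElem.eq, mul_assoc, hwp]
  have hpe : ∀ g, p g * (p g - w g * star (w g)) = p g - w g * star (w g) := fun g => by
    rw [mul_sub, (hp g).isIdempotentElem.eq, ← mul_assoc, hpw]
  refine ⟨isStarProjection_sum _ hw1 hw0, fun g => ?_, fun g h hgh => ?_, fun g => ?_⟩
  · refine IsStarProjection.sub_of_mul_eq_left (hw1 g) (hp g) ?_
    rw [mul_assoc, hwp]
  · rw [← hep g, ← hpe h, mul_assoc, ← mul_assoc (p g), ho g h hgh, zero_mul, mul_zero]
  · rw [← hep g, mul_assoc, mul_sub, mul_one, Finset.mul_sum, Finset.sum_eq_single g,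
      (hp g).isIdempotentElem.eq, sub_self, mul_zero]
    · exact fun h _ hh => ho g h hh.symm
    · simp

end Main

end TracialApproximation

theorem mainTheorem4 {G : Type v} [Group G] [Fintype G]
    (𝒞 : TracialApproximation.CStarClass.{max u v})
    (h_iso : ∀ (B C : Type (max u v)) [CStarAlgebra B] [CStarAlgebra C],
      𝒞 B → Nonempty (C ≃⋆ₐ[ℂ] B) → 𝒞 C)
    (h_matrix : ∀ (B : Type (max u v)) [CStarAlgebra B] (n : ℕ), 1 ≤ n → 𝒞 B →
      @𝒞 (CStarMatrix (Fin n) (Fin n) B) (TracialApproximation.matrixCStarAlgebra (Fin n) B))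
    (h_corner : ∀ (B : Type (max u v)) [CStarAlgebra B] (p : B) (hp : IsStarProjection p),
      p ≠ 0 → 𝒞 B → 𝒞 (TracialApproximation.UnitalCStarSubalgebra.corner p hp).Carrier)
    (A : Type (max u v)) [CStarAlgebra A]
    (hA_simple : TracialApproximation.IsSimple A)
    (hA_TA : TracialApproximation.TA 𝒞 A)
    (α : G →* (A ≃⋆ₐ[ℂ] A))
    (hα : TracialApproximation.HasTracialRokhlinProperty α) :
    TracialApproximation.TA 𝒞 (TracialApproximation.CrossedProduct α) := by
  classical
  open TracialApproximation CrossedProduct in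
  intro F ε a hε ha ha0
  obtain ⟨c, hc, hc0, hdom⟩ := exists_isRokhlinFamily_cuntzLE hA_simple hα ha ha0
  -- all twisted coefficients of the elements of `F`
  let F₁ : Finset A := F.biUnion fun Y =>
    Finset.univ.image fun gk : G × G => α gk.1⁻¹ (Y gk.2)
  have hF₁ : ∀ Y ∈ F, ∀ g k, α g⁻¹ (Y k) ∈ F₁ := fun Y hY g k =>
    Finset.mem_biUnion.2 ⟨Y, hY, Finset.mem_image.2 ⟨(g, k), Finset.mem_univ _, rfl⟩⟩
  choose p hp hpdom using fun n : ℕ =>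
    hdom F₁ (1 / ((n : ℝ) + 1)) (by positivity)
  choose q r hq hr hr0 hrq hqp hqF hqc hE using fun n : ℕ =>
    TA.exists_corner h_corner hA_TA hA_simple F₁ (δ := 1 / ((n : ℝ) + 1)) (by positivity) hc hc0
      ((hp n).proj 1) ((hp n).ne_zero 1)
  obtain ⟨w, hw, hwr, hpw, hwF, hwe⟩ := exists_partialIsometries hp hq hr hrq hqp hqF
  -- a stage at which all errors are small
  have hev1 : ∀ᶠ n in atTop, ∀ Y ∈ F,
      ‖(∑ g, w n g * star (w n g)) * Y - Y * ∑ g, w n g * star (w n g)‖ < ε :=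
    (Finset.eventually_all F).2 fun Y hY => ((hwF Y (hF₁ Y hY)).1).eventually (gt_mem_nhds hε)
  have hev2 : ∀ᶠ n in atTop, ∀ Y ∈ F,
      ‖(∑ g, w n g * star (w n g)) * Y * (∑ g, w n g * star (w n g)) -
        ∑ g, ∑ h, w n g * incl α (r n * α g⁻¹ (Y (g * h⁻¹)) * r n) * star (w n h)‖ < ε / 2 :=
    (Finset.eventually_all F).2 fun Y hY =>
      ((hwF Y (hF₁ Y hY)).2).eventually (gt_mem_nhds (by positivity))
  have hev3 : ∀ᶠ n in atTop, ∀ g, ‖(incl α (p n g) - w n g * star (w n g)) -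
      (unitary α g * incl α (p n 1)) * incl α (1 - q n) *
        star (unitary α g * incl α (p n 1))‖ < 1 / 4 :=
    eventually_all.2 fun g => (hwe g).eventually (gt_mem_nhds (by norm_num))
  have hN : (0 : ℝ) < Fintype.card G * Fintype.card G := by
    have : (0 : ℝ) < Fintype.card G := by exact_mod_cast Fintype.card_pos
    positivity
  have hev4 : ∀ᶠ n : ℕ in atTop,
      1 / ((n : ℝ) + 1) < ε / 2 / (Fintype.card G * Fintype.card G) :=
    tendsto_one_div_add_atTop_nhds_zero_nat.eventually (gt_mem_nhds (by positivity))
  obtain ⟨n, hw, hn1, hn2, hn3, hn4⟩ :=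
    (hw.and (hev1.and (hev2.and (hev3.and hev4)))).exists
  obtain ⟨E, _, i, hi, hi1, hCE, happ⟩ := hE n
  let ι : A →⋆ₙₐ[ℂ] CrossedProduct α := (incl α : A →⋆ₐ[ℂ] CrossedProduct α).toNonUnitalStarAlgHom
  have hj1 : (ι.comp i) 1 = incl α (r n) := congrArg (incl α) hi1
  obtain ⟨D, hD1, hDC, hDM⟩ := exists_subalgebra_mem_class h_iso h_matrix hCE (ι.comp i)
    (incl_injective.comp hi) (w n) (by simpa only [hj1] using hw)
    (fun g => by rw [hj1]; exact hwr n g)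
  obtain ⟨hQ, heproj, heo, her⟩ := isStarProjection_of_partialIsometries
    (fun g => ((hp n).proj g).map (incl α))
    (fun g h hgh => by rw [← map_mul, (hp n).orth g h hgh, map_zero]) hw (hwr n) (hpw n)
  set Q := ∑ g, w n g * star (w n g) with hQdef
  have hwn : ∀ g, ‖w n g‖ ≤ 1 := by
    intro g
    -- `w_g⋆ w_g` is a projection
    have h1 := CStarRing.norm_star_mul_self (x := w n g)
    rw [hw, if_pos rfl] at h1
    have h2 := IsStarProjection.norm_le_one ((hr n).map (incl α))
    nlinarith [norm_nonneg (w n g)]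
  refine ⟨Q, D, hQ, ?_, hD1, hDC, ?_, fun Y hY => ?_, ?_⟩
  · -- `Q` fixes `w_1`, whose initial projection `r` is nonzero
    intro h0
    have h1 : Q * w n 1 = w n 1 := by
      rw [hQdef, Finset.sum_mul, Finset.sum_eq_single 1]
      · rw [mul_assoc, hw, if_pos rfl, hwr]
      · intro g _ hg
        rw [mul_assoc, hw, if_neg hg, mul_zero]
      · simp
    have h2 := hw 1 1
    rw [if_pos rfl, ← h1, h0, zero_mul, mul_zero, ← map_zero (incl α)] at h2
    exact hr0 n (incl_injective h2).symm
  · exact hn1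
  · choose e he using fun g h => happ (α g⁻¹ (Y (g * h⁻¹))) (hF₁ Y hY g _)
    refine ⟨_, hDM e, ?_⟩
    have h1 : ∀ g h, ‖w n g * incl α (r n * α g⁻¹ (Y (g * h⁻¹)) * r n) * star (w n h) -
        w n g * (ι.comp i) (e g h) * star (w n h)‖ ≤ 1 / ((n : ℝ) + 1) := by
      intro g h
      have h2 : w n g * incl α (r n * α g⁻¹ (Y (g * h⁻¹)) * r n) * star (w n h) -
          w n g * (ι.comp i) (e g h) * star (w n h) =
          w n g * incl α (r n * α g⁻¹ (Y (g * h⁻¹)) * r n - i (e g h)) * star (w n h) := by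
        rw [map_sub, mul_sub, sub_mul]; rfl
      rw [h2]
      have h3 : ‖star (w n h)‖ ≤ 1 := by rw [norm_star]; exact hwn h
      calc _ ≤ ‖w n g‖ * ‖incl α (r n * α g⁻¹ (Y (g * h⁻¹)) * r n - i (e g h))‖ *
            ‖star (w n h)‖ := norm_mul₃_le
        _ ≤ 1 * (1 / ((n : ℝ) + 1)) * 1 := by
          have := (norm_incl_le (α := α) _).trans (he g h).le
          have := hwn g
          gcongr
        _ = _ := by ring
    have h4 : ‖∑ g, ∑ h, w n g * incl α (r n * α g⁻¹ (Y (g * h⁻¹)) * r n) * star (w n h) -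
        ∑ g, ∑ h, w n g * (ι.comp i) (e g h) * star (w n h)‖ ≤
        Fintype.card G * Fintype.card G * (1 / ((n : ℝ) + 1)) := by
      simp only [← Finset.sum_sub_distrib]
      calc _ ≤ ∑ g : G, ∑ h : G, 1 / ((n : ℝ) + 1) :=
            (norm_sum_le _ _).trans (Finset.sum_le_sum fun g _ =>
              (norm_sum_le _ _).trans (Finset.sum_le_sum fun h _ => h1 g h))
        _ = _ := by simp; ring
    have h5 : Fintype.card G * Fintype.card G * (1 / ((n : ℝ) + 1)) < ε / 2 := by
      rw [lt_div_iff₀ hN] at hn4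
      linarith
    linarith [hn2 Y hY, norm_sub_le_norm_sub_add_norm_sub (Q * Y * Q)
      (∑ g, ∑ h, w n g * incl α (r n * α g⁻¹ (Y (g * h⁻¹)) * r n) * star (w n h))
      (∑ g, ∑ h, w n g * (ι.comp i) (e g h) * star (w n h))]
  · have hsum : 1 - Q = incl α (1 - ∑ g, p n g) +
        ∑ g, (incl α (p n g) - w n g * star (w n g)) := by
      rw [Finset.sum_sub_distrib, map_sub, map_sum, map_one]
      abel
    rw [hsum]
    refine hpdom n _ heproj heo (fun g => ?_) fun g => ?_
    · rw [map_sub, map_sum, map_one]; exact her g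
    · obtain ⟨v, hv⟩ := cuntzLE_iff.1 ((hqc n).map (incl α)) (1 / 4) (by norm_num)
      set b := unitary α g * incl α (p n 1) with hb
      have hbn : ‖b‖ ≤ 1 := by
        have h1 := CStarRing.norm_star_mul_self (x := b)
        have h2 : star b * b = incl α (p n 1) := by
          rw [hb, star_mul, star_unitary, ← map_star, ((hp n).proj 1).isSelfAdjoint.star_eq,
            mul_assoc, ← mul_assoc (unitary α g⁻¹), unitary_mul_unitary, inv_mul_cancel,
            unitary_one, one_mul, ← map_mul, ((hp n).proj 1).isIdempotentElem.eq]
        have h3 := IsStarProjection.norm_le_one (((hp n).proj 1).map (incl α))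
        rw [h2] at h1
        nlinarith [norm_nonneg b]
      refine IsStarProjection.cuntzLE_of_norm_le (v := b * v) (heproj g)
        (hc.map (incl α)).isSelfAdjoint ?_
      have h1 : (incl α (p n g) - w n g * star (w n g)) - b * v * incl α c * star (b * v) =
          ((incl α (p n g) - w n g * star (w n g)) - b * incl α (1 - q n) * star b) +
            b * (incl α (1 - q n) - v * incl α c * star v) * star b := by
        rw [star_mul]; noncomm_ring
      have h2 : ‖b * (incl α (1 - q n) - v * incl α c * star v) * star b‖ ≤ 1 / 4 := by
        have h3 : ‖star b‖ ≤ 1 := by rw [norm_star]; exact hbn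
        calc _ ≤ ‖b‖ * ‖incl α (1 - q n) - v * incl α c * star v‖ * ‖star b‖ := norm_mul₃_le
          _ ≤ 1 * (1 / 4) * 1 := by gcongr
          _ = _ := by norm_num
      rw [h1]
      have h4 := hn3 g
      linarith [norm_add_le ((incl α (p n g) - w n g * star (w n g)) -
        b * incl α (1 - q n) * star b) (b * (incl α (1 - q n) - v * incl α c * star v) * star b)]
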